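/- Let $s,k\ge 1$. Consider $u_t+u_x=0$ on $[a,b]\times(0,T]$ with the periodic condition $u(a,t)=u(b,t)$ or the homogeneous inflow condition $u(a,t)=0$. **Scheme RKSV(s,k).** Let $a=x_{1/2}<\dots<x_{N+1/2}=b$, $I_i=[x_{i-1/2},x_{i+1/2}]$, $h_i=|I_i|$, $h=\max_i h_i$, and assume the mesh is regular: $r\,h\le\min_i h_i$ with a constant $r>0$. Let $-1=y_0<y_1<\dots<y_k<y_{k+1}=1$, where $y_1,\dots,y_k$ are the zeros of the Legendre polynomial $P_k$ (LSV) or the zeros in $(-1,1)$ of $P_{k+1}-P_k$ (right Radau points, RRSV), let $x_{i,j}$ be the affine image of $y_j$ in $I_i$ and $C_{i,j}=[x_{i,j},x_{i,j+1}]$, $0\le j\le k$. Let $\mathcal U_h$ be the space of piecewise polynomials of degree $\le k$ on the mesh, and let $v^-_{i,j}$ be the left limit of $v$ at $x_{i,j}$, where the left limit at $a$ is $v(b^-)$ (periodic) or $0$ (inflow). Put $g_{0,0}=1$ and, for $s\ge2$, $g_{s-1,\ell}=\frac1\ell g_{s-2,\ell-1}$ $(1\le\ell\le s-2)$, $g_{s-1,s-1}=\frac1{s!}$,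 $g_{s-1,0}=1-\sum_{\ell=1}^{s-1}g_{s-1,\ell}$. With $\tau=T/M$, $0\le n<M$, $u^{n,0}=u^n$, $u^{n,s}=u^{n+1}$, the stages $u^{n,\ell}\in\mathcal U_h$ satisfy for all $i,j$ and $0\le\ell<s$ $$\int_{C_{i,j}}u^{n,\ell+1}=\sum_{\kappa\le\ell}\Big[c_{\ell\kappa}\int_{C_{i,j}}u^{n,\kappa}-\tau d_{\ell\kappa}\big((u^{n,\kappa})^-_{i,j+1}-(u^{n,\kappa})^-_{i,j}\big)\Big],$$ where $c_{\ell\kappa}=d_{\ell\kappa}=\delta_{\ell\kappa}$ for $\ell<s-1$, $c_{s-1,\kappa}=g_{s-1,\kappa}$ and $d_{s-1,\kappa}=g_{s-1,s-1}\delta_{s-1,\kappa}$. The CFL number is $\lambda=\tau/h$. **Energy norm.** Let $A_j$ be the weights on $[-1,1]$ of the interpolatory (Gauss) quadrature with nodes $y_1,\dots,y_k$ and $A_0=A_{k+1}=0$ for LSV, and of the (right Radau) quadrature with nodes $y_1,\dots,y_{k+1}$ and $A_0=0$ for RRSV. For $w\in\mathcal U_h$ let $w^*$ be the function equal to the constant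 $w^*_{i,j}=w(x_{i-1/2}^+)+\sum_{l=0}^{j}\frac{h_i}2A_l\,(w|_{I_i})_x(x_{i,l})$ on $C_{i,j}$, let $(v,w^*)=\int_a^b v\,w^*\,dx$ and $|||w|||=(w,w^*)^{1/2}$. **Matrix transferring process.** Write $\mathbb D_0u^n=u^n$ and let $\mathbb D_pu^n\in\mathcal U_h$ be given by $\int_{C_{i,j}}\mathbb D_pu^n=-\tau\big((\mathbb D_{p-1}u^n)^-_{i,j+1}-(\mathbb D_{p-1}u^n)^-_{i,j}\big)$. The scheme takes the form $\alpha_0u^{n+1}=\sum_{p=0}^s\alpha_p\mathbb D_pu^n$, with $\alpha_0>0$ a free scaling factor. That is, $\alpha_0P_s(X)=\sum_p\alpha_pX^p$, where $P_0=1$ and $P_{\ell+1}=\sum_{\kappa\le\ell}(c_{\ell\kappa}+d_{\ell\kappa}X)P_\kappa$. For $0\le p,q\le s$ set $a^{(0)}_{00}=0$, $a^{(0)}_{pq}=\alpha_p\alpha_q$ if $p+q>0$, $b^{(0)}_{pq}=0$ (entries with an index larger than $s$ are read as $0$). For $l\ge1$ and $p\ge q$, $$a^{(l)}_{pq}=a^{(l)}_{qp}=\begin{cases}0,&q\le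 l-1,\\a^{(l-1)}_{pq}-2a^{(l-1)}_{p+1,q-1},&p=q=l,\\a^{(l-1)}_{pq}-a^{(l-1)}_{p+1,q-1},&l+1\le p\le s-1,\ q=l,\\a^{(l-1)}_{pq},&\text{otherwise,}\end{cases}\qquad b^{(l)}_{pq}=b^{(l)}_{qp}=\begin{cases}2a^{(l-1)}_{p+1,q},&l-1\le p\le s-1,\ q=l-1,\\b^{(l-1)}_{pq},&\text{otherwise.}\end{cases}$$ The termination index $\zeta$ is the least $l\ge1$ with $a^{(l)}_{ll}\ne0$. The indicator (contribution) index $\rho$ is the least $\kappa\in\{0,\dots,\zeta-1\}$ with $\det(b^{(\zeta)}_{pq})_{0\le p,q\le\kappa}\le0$, and $\rho=\zeta$ if there is none. **Theorem.** The process terminates with $1\le\zeta\le s$. The norm $|||\cdot|||$ is equivalent to the $L_2$ norm on $\mathcal U_h$, with constants that do not depend on $a,b$ or the mesh. Moreover, there are $\lambda_0>0$ and $C>0$, which do not depend on $a$, $b$, the mesh (given $r$), $\tau$, $T$, $n$ or the solution, such that whenever $\lambda\le\lambda_0$, every solution of RKSV(s,k) satisfies for all $0\le n<M$: 1. if $a^{(\zeta)}_{\zeta\zeta}<0$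 and $\rho=\zeta$, then $|||u^{n+1}|||^2\le|||u^n|||^2$ (monotonicity stability); 2. if $a^{(\zeta)}_{\zeta\zeta}<0$ and $\rho<\zeta$, then $|||u^{n+1}|||^2\le(1+C\lambda^{2\rho+1})|||u^n|||^2$ (weak$(2\rho+1)$ stability); 3. if $a^{(\zeta)}_{\zeta\zeta}>0$, then $|||u^{n+1}|||^2\le(1+C\lambda^{\gamma})|||u^n|||^2$ with $\gamma=\min(2\zeta,2\rho+1)$ (weak$(\gamma)$ stability). -/

import Mathlib

noncomputable section

namespace RKSV

open Polynomial

/-! ### Time discretization: SSP Runge–Kutta coefficients -/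

/-- The coefficients `g_{m,ℓ}`: `g_{0,0} = 1`, and for the `(m+2)`-stage method
`g_{m+1,ℓ} = g_{m,ℓ-1} / ℓ` for `1 ≤ ℓ ≤ m`, `g_{m+1,m+1} = 1 / (m+2)!` and
`g_{m+1,0} = 1 - ∑_{ℓ=1}^{m+1} g_{m+1,ℓ}`. They vanish for `ℓ > m`. -/
def sspG : ℕ → ℕ → ℝ
  | 0, l => if l = 0 then 1 else 0
  | m + 1, l =>
    let pos : ℕ → ℝ := fun r =>
      if r = m + 1 then 1 / ((m + 2).factorial : ℝ)
      else if r ≤ m then 1 / (r : ℝ) * sspG m (r - 1)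
      else 0
    if l = 0 then 1 - ∑ r ∈ Finset.Icc 1 (m + 1), pos r else pos l

/-- Entry `c_{ℓκ}` (`κ ≤ ℓ < s`) of the Shu–Osher form of the `s`-stage SSP method. -/
def rkC (s l κ : ℕ) : ℝ :=
  if l + 1 = s then sspG (s - 1) κ else if κ = l then 1 else 0

/-- Entry `d_{ℓκ}` (`κ ≤ ℓ < s`) of the Shu–Osher form of the `s`-stage SSP method. -/
def rkD (s l κ : ℕ) : ℝ :=
  if κ = l then (if l + 1 = s then sspG (s - 1) (s - 1) else 1) else 0

/-! ### The matrix transferring process -/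

/-- The stage polynomials `P_ℓ` of the Runge–Kutta method: if the spatial operator is `L` and
`K = τ L`, then the stages are `u^{n,ℓ} = P_ℓ(K) u^n`, because
`u^{n,ℓ+1} = ∑_{κ ≤ ℓ} (c_{ℓκ} u^{n,κ} + d_{ℓκ} K u^{n,κ})`. -/
def stagePoly (s : ℕ) : ℕ → ℝ[X]
  | 0 => 1
  | l + 1 => ∑ κ : Fin (l + 1), (C (rkC s l κ) + C (rkD s l κ) * X) * stagePoly s κ

/-- The coefficients `α_p` of the evolution identity `α₀ u^{n+1} = ∑_{p ≤ s} α_p 𝔻_p u^n`, where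
`𝔻_0 u^n = u^n` and `𝔻_p u^n = K 𝔻_{p-1} u^n` are the temporal differences (combinations of the
stages). As `u^{n+1} = P_s(K) u^n` and `𝔻_p u^n = K^p u^n`, this is `α₀ P_s = ∑_p α_p X^p`.
The number `α₀ > 0` is a free scaling factor. -/
def evolutionCoeff (s : ℕ) (α₀ : ℝ) (p : ℕ) : ℝ := α₀ * (stagePoly s s).coeff p

/-- The initial matrix: `a_{00} = 0` and `a_{pq} = α_p α_q` for `p + q > 0`, `0 ≤ p, q ≤ s`
(entries with an index larger than `s` are zero). -/
def initialA (s : ℕ) (α₀ : ℝ) (p q : ℕ) : ℝ :=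
  if 0 < p + q ∧ p ≤ s ∧ q ≤ s then evolutionCoeff s α₀ p * evolutionCoeff s α₀ q else 0

/-- The matrices `𝔸^{(l)}`. They are symmetric, and the recursion is written for the entry
with row index `max p q` and column index `min p q`. -/
def transferA (s : ℕ) (α₀ : ℝ) : ℕ → ℕ → ℕ → ℝ
  | 0, p, q => initialA s α₀ p q
  | l + 1, p, q =>
    let i := max p q
    let j := min p q
    if j ≤ l then 0
    else if i = l + 1 ∧ j = l + 1 then
      transferA s α₀ l i j - 2 * transferA s α₀ l (i + 1) (j - 1)
    else if l + 2 ≤ i ∧ i ≤ s - 1 ∧ j = l + 1 then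
      transferA s α₀ l i j - transferA s α₀ l (i + 1) (j - 1)
    else transferA s α₀ l i j

/-- The matrices `𝔹^{(l)}` (symmetric, same convention). -/
def transferB (s : ℕ) (α₀ : ℝ) : ℕ → ℕ → ℕ → ℝ
  | 0, _, _ => 0
  | l + 1, p, q =>
    let i := max p q
    let j := min p q
    if l ≤ i ∧ i ≤ s - 1 ∧ j = l then 2 * transferA s α₀ l (i + 1) j
    else transferB s α₀ l p q

/-- The termination index `ζ`: the first `l ≥ 1` with `a_{ll}^{(l)} ≠ 0`. -/
def terminationIndex (s : ℕ) (α₀ : ℝ) : ℕ :=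
  sInf {l : ℕ | 1 ≤ l ∧ l ≤ s ∧ transferA s α₀ l l l ≠ 0}

/-- The set of all `κ` with `0 ≤ κ ≤ ζ - 1` for which the leading principal minor of order
`κ + 1` of `𝔹^{(ζ)}` is nonpositive. -/
def nonposMinors (s : ℕ) (α₀ : ℝ) : Set ℕ :=
  {κ : ℕ | κ < terminationIndex s α₀ ∧
    (Matrix.of fun p q : Fin (κ + 1) =>
      transferB s α₀ (terminationIndex s α₀) p q).det ≤ 0}

open Classical in
/-- The contribution (indicator) index `ρ`. -/
def contributionIndex (s : ℕ) (α₀ : ℝ) : ℕ :=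
  if (nonposMinors s α₀).Nonempty then sInf (nonposMinors s α₀) else terminationIndex s α₀

/-! ### Space discretization: spectral volumes -/

/-- The two choices of subdividing points: Gauss–Legendre (LSV) and right Radau (RRSV). -/
inductive SVKind
  | LSV
  | RRSV

/-- The boundary condition: `u(a,t) = u(b,t)`, or `u(a,t) = 0`. -/
inductive BoundaryCondition
  | periodic
  | inflow

/-- The Legendre polynomial of degree `n` (Rodrigues' formula). -/
def legendre (n : ℕ) : ℝ[X] :=
  C (1 / (2 ^ n * (n.factorial : ℝ))) * derivative^[n] ((X ^ 2 - 1) ^ n)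

/-- The polynomial whose zeros in `(-1,1)` are the interior subdividing points:
`P_k` for LSV and `P_{k+1} - P_k` for RRSV (the latter also vanishes at `1`). -/
def nodePoly (kind : SVKind) (k : ℕ) : ℝ[X] :=
  match kind with
  | SVKind.LSV => legendre k
  | SVKind.RRSV => legendre (k + 1) - legendre k

/-- `-1 = y_0 < y_1 < ⋯ < y_k < y_{k+1} = 1` are the subdividing points of `[-1,1]`: the interior
points are the Gauss–Legendre points, resp. the interior right Radau points. As the node
polynomial has exactly `k` zeros in `(-1,1)`, all simple, this determines `y`. -/
structure IsSubdivision (kind : SVKind) (k : ℕ) (y : Fin (k + 2) → ℝ) : Prop where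
  strictMono : StrictMono y
  first : y 0 = -1
  last : y (Fin.last (k + 1)) = 1
  root : ∀ j, j ≠ 0 → j ≠ Fin.last (k + 1) → (nodePoly kind k).IsRoot (y j)

/-- The nodes used by the quadrature: `y_1, …, y_k` for LSV (Gauss quadrature) and
`y_1, …, y_{k+1}` for RRSV (right Radau quadrature). -/
def quadNodes (kind : SVKind) (k : ℕ) : Finset (Fin (k + 2)) :=
  match kind with
  | SVKind.LSV => Finset.univ.filter fun j => j ≠ 0 ∧ j ≠ Fin.last (k + 1)
  | SVKind.RRSV => Finset.univ.filter fun j => j ≠ 0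

/-- The weights `A_j` of the interpolatory quadrature `∑_{j=0}^{k+1} A_j f(y_j)` on `[-1,1]`. -/
def quadWeight (kind : SVKind) (k : ℕ) (y : Fin (k + 2) → ℝ) (j : Fin (k + 2)) : ℝ :=
  if j ∈ quadNodes kind k then
    ∫ t in (-1 : ℝ)..1, (Lagrange.basis (quadNodes kind k) y j).eval t
  else 0

/-- A partition `a = x_{1/2} < x_{3/2} < ⋯ < x_{N+1/2} = b` of `[a,b]` into `N` elements. -/
structure Mesh (a b : ℝ) (N : ℕ) where
  pts : Fin (N + 1) → ℝ
  strictMono : StrictMono pts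
  first : pts 0 = a
  last : pts (Fin.last N) = b

namespace Mesh

variable {a b : ℝ} {N : ℕ} (m : Mesh a b N)

/-- Left endpoint of an element. -/
def left (i : Fin N) : ℝ := m.pts i.castSucc

/-- Right endpoint of an element. -/
def right (i : Fin N) : ℝ := m.pts i.succ

/-- Length of an element. -/
def len (i : Fin N) : ℝ := m.right i - m.left i

/-- The mesh size `h`, the maximal length of an element. -/
def hmax : ℝ := ⨆ i, m.len i

/-- The minimal length of an element. -/
def hmin : ℝ := ⨅ i, m.len i

/-- The partition is regular with constant `r`. -/
def IsRegular (r : ℝ) : Prop := r * m.hmax ≤ m.hmin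

/-- The point `x_{i,j}`, the affine image of `y_j` in the `i`-th element. -/
def point {k : ℕ} (y : Fin (k + 2) → ℝ) (i : Fin N) (j : Fin (k + 2)) : ℝ :=
  m.len i / 2 * y j + (m.left i + m.right i) / 2

end Mesh

/-- The space `𝒰_h` of piecewise polynomials of degree at most `k`: one polynomial in the physical
variable `x` for every element. -/
abbrev TrialSpace (N k : ℕ) : Type := Fin N → Polynomial.degreeLT ℝ (k + 1)

section Forms

variable {a b : ℝ} {N k : ℕ}

/-- The left limit `v^-` at the left end of the `i`-th element: the value of `v` from the preceding
element; at `x = a` it is given by the boundary condition. -/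
def upwindTrace (bc : BoundaryCondition) (m : Mesh a b N) (v : TrialSpace N k) (i : Fin N) : ℝ :=
  if (i : ℕ) = 0 then
    match bc with
    | BoundaryCondition.periodic =>
      (v ⟨N - 1, by have := i.isLt; omega⟩ : ℝ[X]).eval b
    | BoundaryCondition.inflow => 0
  else
    (v ⟨(i : ℕ) - 1, by have := i.isLt; omega⟩ : ℝ[X]).eval (m.left i)

/-- The left limit `v_{i,j}^-` at `x_{i,j}`. -/
def leftTrace (bc : BoundaryCondition) (m : Mesh a b N) (y : Fin (k + 2) → ℝ)
    (v : TrialSpace N k) (i : Fin N) (j : Fin (k + 2)) : ℝ :=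
  if j = 0 then upwindTrace bc m v i else (v i : ℝ[X]).eval (m.point y i j)

/-- The integral of `v` over the control volume `C_{i,j} = [x_{i,j}, x_{i,j+1}]`. -/
def cvIntegral (m : Mesh a b N) (y : Fin (k + 2) → ℝ)
    (v : TrialSpace N k) (i : Fin N) (j : Fin (k + 1)) : ℝ :=
  ∫ x in (m.point y i j.castSucc)..(m.point y i j.succ), (v i : ℝ[X]).eval x

/-- The value `w*_{i,j}` on `C_{i,j}` of the piecewise constant `w* = T w`:
`w*_{i,0} = w^+_{i-1/2} + A_{i,0} w_x(x_{i,0})`, `w*_{i,j} - w*_{i,j-1} = A_{i,j} w_x(x_{i,j})`, with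
`A_{i,j} = (h_i / 2) A_j`. -/
def testMap (kind : SVKind) (m : Mesh a b N) (y : Fin (k + 2) → ℝ)
    (w : TrialSpace N k) (i : Fin N) (j : Fin (k + 1)) : ℝ :=
  (w i : ℝ[X]).eval (m.left i) +
    ∑ r ∈ Finset.univ.filter (fun r : Fin (k + 2) => r ≤ j.castSucc),
      m.len i / 2 * quadWeight kind k y r * (derivative (w i : ℝ[X])).eval (m.point y i r)

/-- The inner product `(v, w*)`. -/
def energyInner (kind : SVKind) (m : Mesh a b N) (y : Fin (k + 2) → ℝ)
    (v w : TrialSpace N k) : ℝ :=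
  ∑ i, ∑ j, testMap kind m y w i j * cvIntegral m y v i j

/-- The energy norm `|||w||| = (w, w*)^{1/2}`. -/
def energyNorm (kind : SVKind) (m : Mesh a b N) (y : Fin (k + 2) → ℝ)
    (w : TrialSpace N k) : ℝ :=
  √(energyInner kind m y w w)

/-- The `L₂(a,b)` norm of a piecewise polynomial. -/
def l2Norm (m : Mesh a b N) (w : TrialSpace N k) : ℝ :=
  √(∑ i, ∫ x in (m.left i)..(m.right i), (w i : ℝ[X]).eval x ^ 2)

/-- `u'` is obtained from `u` by one step of length `τ` of the scheme RKSV(s,k). -/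
def IsStep (s : ℕ) (bc : BoundaryCondition) (m : Mesh a b N) (y : Fin (k + 2) → ℝ) (τ : ℝ)
    (u u' : TrialSpace N k) : Prop :=
  ∃ U : ℕ → TrialSpace N k, U 0 = u ∧ U s = u' ∧
    ∀ l < s, ∀ i j,
      cvIntegral m y (U (l + 1)) i j =
        ∑ κ ∈ Finset.range (l + 1),
          (rkC s l κ * cvIntegral m y (U κ) i j -
            τ * rkD s l κ *
              (leftTrace bc m y (U κ) i j.succ - leftTrace bc m y (U κ) i j.castSucc))

end Forms

/-! ### Stability -/

/-- For all intervals `[a,b]`, all regular meshes with constant `r`, all `T > 0` and `M ≥ 1` with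
`τ = T / M` and CFL number `λ = τ / h ≤ lam₀`, all solutions of the scheme satisfy
`|||u^{n+1}|||² ≤ φ(λ) |||u^n|||²` for `0 ≤ n < M`. -/
def GrowthBound (s k : ℕ) (kind : SVKind) (bc : BoundaryCondition) (y : Fin (k + 2) → ℝ)
    (r lam₀ : ℝ) (φ : ℝ → ℝ) : Prop :=
  ∀ (a b : ℝ), a < b → ∀ (N : ℕ) (m : Mesh a b N), m.IsRegular r →
    ∀ (T : ℝ) (M : ℕ), 0 < T → 1 ≤ M → T / M / m.hmax ≤ lam₀ →
      ∀ u : ℕ → TrialSpace N k,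
        (∀ n < M, IsStep s bc m y (T / M) (u n) (u (n + 1))) →
          ∀ n < M, energyNorm kind m y (u (n + 1)) ^ 2 ≤
            φ (T / M / m.hmax) * energyNorm kind m y (u n) ^ 2

/-- Monotonicity stability, for a small enough CFL number. -/
def MonotonicityStable (s k : ℕ) (kind : SVKind) (bc : BoundaryCondition)
    (y : Fin (k + 2) → ℝ) (r : ℝ) : Prop :=
  ∃ lam₀ : ℝ, 0 < lam₀ ∧ GrowthBound s k kind bc y r lam₀ fun _ => 1

/-- Weak(`γ`) stability: `|||u^{n+1}|||² ≤ (1 + C λ^γ) |||u^n|||²` for a small enough CFL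
number `λ`, with a constant `C` independent of the mesh, the time step, `n` and the solution. -/
def WeakStable (γ s k : ℕ) (kind : SVKind) (bc : BoundaryCondition)
    (y : Fin (k + 2) → ℝ) (r : ℝ) : Prop :=
  ∃ C : ℝ, 0 < C ∧ ∃ lam₀ : ℝ, 0 < lam₀ ∧
    GrowthBound s k kind bc y r lam₀ fun lam => 1 + C * lam ^ γ

/-- The energy norm is equivalent to the `L₂` norm, uniformly in the interval and the mesh. -/
def NormEquivalence (k : ℕ) (kind : SVKind) (y : Fin (k + 2) → ℝ) : Prop :=
  ∃ c₁ c₂ : ℝ, 0 < c₁ ∧ 0 < c₂ ∧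
    ∀ (a b : ℝ), a < b → ∀ (N : ℕ) (m : Mesh a b N) (w : TrialSpace N k),
      c₁ * l2Norm m w ≤ energyNorm kind m y w ∧ energyNorm kind m y w ≤ c₂ * l2Norm m w

end RKSV

end

/-!
The scheme is a Runge–Kutta method for one linear operator, and the theorem is an energy estimate
for that operator.

*Space.* Testing the control volume equations with `w*` turns the scheme into a Galerkin method.
On the reference element the jumps of `w*` are quadrature weights times `w'`, so Abel summation
expresses both sides by the quadrature of `w' F`, where `F` is `v` for the fluxes and an
antiderivative of `v` for the averages (`exists_refForm`). The rule is exact in degree `2k - 1`,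
because its nodal polynomial is orthogonal to all polynomials of degree less than `k`. Hence the
fluxes give the upwind form `H(v, w) = ∑ᵢ ∫ w v_x + w⁺ [v]`. The averages reach degree `2k`, where
the quadrature error is a nonnegative multiple of the top coefficient (`exists_quadrature_error`),
so `(v, w*)` is the `L₂` product plus a nonnegative multiple of the product of the top coefficients.
It is therefore a scalar product, equivalent to the `L₂` product. Let `K` represent `-τ H` with
respect to it. Then `(Kv, v) ≤ 0`, because `H(v, v)` is nonnegative, and `‖K‖ ≤ κ λ` by inverse
inequalities on regular meshes (`exists_dissipative_operator`). One step is `u' = P_s(K) u`.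

*Time.* With `D_p = K^p u` and the positive semidefinite form `S(v, w) = -(Kv, w) - (v, Kw)`, the
transferring process rewrites `α₀² (‖u'‖² - ‖u‖²)` as
`∑ a_{pq} (D_p, D_q) - ½ ∑ b_{pq} S(D_p, D_q)`, and each step is a summation by parts based on
`(D_{p+1}, D_q) + (D_p, D_{q+1}) = -S(D_p, D_q)` (`transferEnergy_succ`). The corner entry
`a_{ss} = α_s²` is never changed and `α_s ≠ 0`, so the process terminates. At termination the
`a`-part is at most `(a_{ζζ} + c μ) ‖D_ζ‖²` with `μ = κ λ`, since every further power of `K` gains a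
factor `μ`. The leading `ρ × ρ` block of `𝔹` is positive definite by Sylvester's criterion, so the
`b`-part is at most `c ∑_{p ≥ ρ} S(D_p, D_p) ≤ c' μ ‖D_ρ‖²` (`exists_leading_lower_bound`). With
`‖D_p‖ ≤ μ^p ‖u‖` the three cases follow by comparing powers of `μ`; if `ρ = ζ` and `a_{ζζ} < 0`,
the first term absorbs the second.
-/

namespace RKSV

open Polynomial

/-! ### Leading principal minors and positive forms -/

/-- The leading `n × n` block of an infinite matrix. -/
def leadingBlock (b : ℕ → ℕ → ℝ) (n : ℕ) : Matrix (Fin n) (Fin n) ℝ :=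
  Matrix.of fun p q => b p q

/-- Sylvester's criterion: in the induction, the quotient of two consecutive leading minors is the
Schur complement of the smaller block. -/
theorem posDef_leadingBlock (b : ℕ → ℕ → ℝ) (hb : ∀ p q, b p q = b q p) (n : ℕ)
    (hdet : ∀ κ < n, 0 < (leadingBlock b (κ + 1)).det) : (leadingBlock b n).PosDef := by
  induction n with
  | zero =>
    refine Matrix.PosDef.of_dotProduct_mulVec_pos (Subsingleton.elim _ _) fun x hx => ?_
    exact absurd (Subsingleton.elim x 0) hx
  | succ n ih =>
    have hA := ih fun κ hκ => hdet κ (by omega)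
    set A := leadingBlock b n
    let B : Matrix (Fin n) (Fin 1) ℝ := Matrix.of fun p _ => b p n
    let D : Matrix (Fin 1) (Fin 1) ℝ := Matrix.of fun _ _ => b n n
    let e : Fin n ⊕ Fin 1 ≃ Fin (n + 1) := finSumFinEquiv
    have hM : (leadingBlock b (n + 1)).submatrix e e = Matrix.fromBlocks A B B.conjTranspose D := by
      ext i j
      rcases i with i | i <;> rcases j with j | j <;>
        simp [leadingBlock, e, A, B, D, hb]
    have : Invertible A := hA.isUnit.invertible
    have hdet' : 0 < (Matrix.fromBlocks A B B.conjTranspose D).det := by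
      rw [← hM, Matrix.det_submatrix_equiv_self]
      exact hdet n (by omega)
    have hA' : 0 < A.det := hA.det_pos
    rw [Matrix.det_fromBlocks₁₁, Matrix.invOf_eq_nonsing_inv] at hdet'
    have hs := pos_of_mul_pos_right hdet' hA'.le
    have hpsd : (Matrix.fromBlocks A B B.conjTranspose D).PosSemidef := by
      rw [Matrix.PosDef.fromBlocks₁₁ _ _ hA]
      rw [Matrix.det_fin_one] at hs
      have : D - B.conjTranspose * A⁻¹ * B
          = Matrix.diagonal fun i => (D - B.conjTranspose * A⁻¹ * B) i i := by
        ext i j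
        rw [Subsingleton.elim j i, Matrix.diagonal_apply_eq]
      rw [this]
      apply Matrix.PosSemidef.diagonal
      intro i
      rw [Subsingleton.elim i 0]
      exact hs.le
    rw [← hM, Matrix.posSemidef_submatrix_equiv] at hpsd
    exact hpsd.posDef_iff_isUnit.2
      ((Matrix.isUnit_iff_isUnit_det _).2 (hdet n (by omega)).ne'.isUnit)

/-- A symmetric matrix becomes positive semidefinite after adding a large multiple of the
identity. -/
theorem exists_posSemidef_add_smul_one {m : Type*} [Fintype m] [DecidableEq m]
    (M : Matrix m m ℝ) (hM : M.IsHermitian) :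
    ∃ c : ℝ, 0 ≤ c ∧ (M + c • (1 : Matrix m m ℝ)).PosSemidef := by
  -- the sum of the absolute values of the entries bounds the operator norm
  refine ⟨∑ i, ∑ j, |M i j|, by positivity, ?_⟩
  apply Matrix.PosSemidef.of_dotProduct_mulVec_nonneg
  · refine hM.add ?_
    simp [Matrix.IsHermitian]
  intro x
  have h1 : ∀ i j, -(|M i j| * ∑ l, x l ^ 2) ≤ x i * (M i j * x j) := by
    intro i j
    have hi : x i ^ 2 ≤ ∑ l, x l ^ 2 :=
      Finset.single_le_sum (f := fun l => x l ^ 2) (fun l _ => sq_nonneg _) (Finset.mem_univ i)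
    have hj : x j ^ 2 ≤ ∑ l, x l ^ 2 :=
      Finset.single_le_sum (f := fun l => x l ^ 2) (fun l _ => sq_nonneg _) (Finset.mem_univ j)
    have h2 : |x i * x j| ≤ ∑ l, x l ^ 2 := by
      rw [abs_le]
      constructor <;> nlinarith [sq_nonneg (x i + x j), sq_nonneg (x i - x j)]
    calc -(|M i j| * ∑ l, x l ^ 2) ≤ -(|M i j| * |x i * x j|) := by gcongr
      _ = -|x i * (M i j * x j)| := by rw [← abs_mul]; congr 2; ring
      _ ≤ _ := neg_abs_le _
  have h3 : star x ⬝ᵥ Matrix.mulVec (M + (∑ i, ∑ j, |M i j|) • (1 : Matrix m m ℝ)) x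
      = ∑ i, ∑ j, (x i * (M i j * x j) + |M i j| * ∑ l, x l ^ 2) := by
    rw [Matrix.add_mulVec, Matrix.smul_mulVec, Matrix.one_mulVec, dotProduct_add]
    simp only [Finset.sum_add_distrib, ← Finset.sum_mul]
    congr 1
    · simp [dotProduct, Matrix.mulVec, Finset.mul_sum]
    · simp [dotProduct, Finset.mul_sum]
      refine Finset.sum_congr rfl fun i _ => ?_
      ring
  rw [h3]
  exact Finset.sum_nonneg fun i _ => Finset.sum_nonneg fun j _ => by linarith [h1 i j]

/-- A positive semidefinite matrix paired with the Gram matrix of a positive semidefinite form gives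
a nonnegative number: with `M = NᵀN` it is a sum of values `S(v, v)`. -/
theorem posSemidef_sum_bilin_nonneg {m V : Type*} [Fintype m] [DecidableEq m] [AddCommGroup V]
    [Module ℝ V] {M : Matrix m m ℝ} (hM : M.PosSemidef) (S : LinearMap.BilinForm ℝ V)
    (hS : ∀ v, 0 ≤ S v v) (D : m → V) : 0 ≤ ∑ i, ∑ j, M i j * S (D i) (D j) := by
  obtain ⟨N, rfl⟩ : ∃ N : Matrix m m ℝ, M = N.conjTranspose * N := by
    open scoped MatrixOrder in
    exact (CStarAlgebra.nonneg_iff_eq_star_mul_self).1 hM.nonneg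
  have : ∑ i, ∑ j, (N.conjTranspose * N) i j * S (D i) (D j)
      = ∑ l, S (∑ i, N l i • D i) (∑ j, N l j • D j) := by
    simp only [map_sum, LinearMap.sum_apply, map_smul, LinearMap.smul_apply, smul_eq_mul,
      Matrix.mul_apply, Matrix.conjTranspose_apply, star_trivial, Finset.sum_mul]
    rw [Finset.sum_comm]
    simp_rw [Finset.mul_sum]
    conv_rhs => rw [Finset.sum_comm]
    refine Finset.sum_congr rfl fun j _ => ?_
    conv_rhs => rw [Finset.sum_comm]
    refine Finset.sum_congr rfl fun i _ => Finset.sum_congr rfl fun l _ => ?_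
    ring
  rw [this]
  exact Finset.sum_nonneg fun l _ => hS _

/-- If the first `ρ` leading principal minors of a symmetric matrix are positive, then the form
`∑ b_{pq} S(D_p, D_q)` is bounded below by the diagonal terms with index at least `ρ`: by
Sylvester's criterion the leading block is positive definite, and its Schur complement becomes
positive semidefinite after adding a multiple of the identity. -/
theorem exists_leading_lower_bound (b : ℕ → ℕ → ℝ) (hb : ∀ p q, b p q = b q p) (ρ n : ℕ)
    (hρ : ρ ≤ n) (hdet : ∀ κ < ρ, 0 < (leadingBlock b (κ + 1)).det) :
    ∃ c : ℝ, 0 ≤ c ∧ ∀ (V : Type) [AddCommGroup V] [Module ℝ V] (S : LinearMap.BilinForm ℝ V),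
      (∀ v, 0 ≤ S v v) → ∀ D : ℕ → V,
        0 ≤ ∑ p ∈ Finset.range n, ∑ q ∈ Finset.range n, b p q * S (D p) (D q) +
          c * ∑ p ∈ Finset.Ico ρ n, S (D p) (D p) := by
  obtain ⟨m, rfl⟩ := Nat.exists_eq_add_of_le hρ
  have hA := posDef_leadingBlock b hb ρ hdet
  set A := leadingBlock b ρ with hAdef
  let B : Matrix (Fin ρ) (Fin m) ℝ := Matrix.of fun p q => b p (ρ + q)
  let D₀ : Matrix (Fin m) (Fin m) ℝ := Matrix.of fun p q => b (ρ + p) (ρ + q)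
  have hinv : Invertible A := hA.isUnit.invertible
  have hherm : (D₀ - B.conjTranspose * A⁻¹ * B).IsHermitian := by
    refine Matrix.IsHermitian.sub ?_ (Matrix.isHermitian_conjTranspose_mul_mul _ hA.1.inv)
    ext i j
    simp [D₀, hb (ρ + j) (ρ + i)]
  obtain ⟨c, hc, hpsd⟩ := exists_posSemidef_add_smul_one _ hherm
  have hblock : (Matrix.fromBlocks A B B.conjTranspose
      (D₀ + c • (1 : Matrix (Fin m) (Fin m) ℝ))).PosSemidef := by
    rw [Matrix.PosDef.fromBlocks₁₁ _ _ hA, add_sub_right_comm]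
    exact hpsd
  refine ⟨c, hc, fun V _ _ S hS D => ?_⟩
  have key := posSemidef_sum_bilin_nonneg hblock S hS
    (Sum.elim (fun i : Fin ρ => D i) fun j : Fin m => D (ρ + j))
  have hsum : ∀ f : ℕ → ℝ, ∑ p ∈ Finset.range (ρ + m), f p
      = ∑ i : Fin ρ, f i + ∑ j : Fin m, f (ρ + j) := by
    intro f
    rw [Finset.sum_range_add, Fin.sum_univ_eq_sum_range f,
      Fin.sum_univ_eq_sum_range (fun j => f (ρ + j))]
  have hIco : ∑ p ∈ Finset.Ico ρ (ρ + m), S (D p) (D p) =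
      ∑ j : Fin m, S (D (ρ + j)) (D (ρ + j)) := by
    rw [Finset.sum_Ico_eq_sum_range, Nat.add_sub_cancel_left,
      Fin.sum_univ_eq_sum_range (fun j => S (D (ρ + j)) (D (ρ + j)))]
  rw [hIco]
  simp only [hsum]
  simp only [Fintype.sum_sum_type, Matrix.fromBlocks_apply₁₁, Matrix.fromBlocks_apply₁₂,
    Matrix.fromBlocks_apply₂₁, Matrix.fromBlocks_apply₂₂, Sum.elim_inl, Sum.elim_inr,
    Matrix.add_apply, Matrix.smul_apply, Matrix.one_apply, add_mul, Finset.sum_add_distrib,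
    smul_eq_mul, mul_ite, mul_one, mul_zero, ite_mul, zero_mul, Finset.sum_ite_eq,
    Finset.mem_univ, if_true, ← Finset.mul_sum] at key ⊢
  have hBt : B.conjTranspose = Matrix.of fun (p : Fin m) (q : Fin ρ) => b (ρ + p) q := by
    ext i j
    simp [B, hb (ρ + i) j]
  rw [hBt] at key
  simp only [A, B, D₀, leadingBlock, Matrix.of_apply] at key
  linarith

/-! ### The transferring process as a summation by parts -/

theorem transferA_comm (s : ℕ) (α₀ : ℝ) (l p q : ℕ) :
    transferA s α₀ l p q = transferA s α₀ l q p := by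
  cases l with
  | zero =>
    simp only [transferA, initialA, add_comm p q, and_comm (a := p ≤ s),
      mul_comm (evolutionCoeff s α₀ p)]
  | succ l => simp only [transferA, max_comm p q, min_comm p q]

theorem transferB_comm (s : ℕ) (α₀ : ℝ) (l p q : ℕ) :
    transferB s α₀ l p q = transferB s α₀ l q p := by
  induction l generalizing p q with
  | zero => rfl
  | succ l ih => simp only [transferB, max_comm p q, min_comm p q, ih p q]

theorem transferA_eq_zero_of_lt (s : ℕ) (α₀ : ℝ) (l p q : ℕ) (hp : s < p) :
    transferA s α₀ l p q = 0 := by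
  induction l generalizing p q with
  | zero => simp [transferA, initialA]; omega
  | succ l ih =>
    have h1 : transferA s α₀ l (max p q) (min p q) = 0 := ih _ _ (by omega)
    have h2 : transferA s α₀ l (max p q + 1) (min p q - 1) = 0 := ih _ _ (by omega)
    simp [transferA, h1, h2]

theorem transferA_eq_zero_of_min_lt (s : ℕ) (α₀ : ℝ) (l p q : ℕ) (h : min p q < l) :
    transferA s α₀ l p q = 0 := by
  cases l with
  | zero => omega
  | succ l => simp only [transferA]; rw [if_pos (by omega)]

theorem transferB_eq_zero_of_le_min (s : ℕ) (α₀ : ℝ) (l p q : ℕ) (h : l ≤ min p q) :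
    transferB s α₀ l p q = 0 := by
  induction l with
  | zero => rfl
  | succ l ih => simp only [transferB]; rw [if_neg (by omega), ih (by omega)]

/-- The entries of column `l` that step `l + 1` of the process removes. -/
noncomputable def removedEntry (s : ℕ) (α₀ : ℝ) (l p : ℕ) : ℝ :=
  if l < p then transferA s α₀ l p l else 0

/-- One step moves the removed entries of column `l` to the next column. -/
theorem transferA_sub_transferA_succ (s : ℕ) (α₀ : ℝ) (l p q : ℕ)
    (h : transferA s α₀ l l l = 0) :
    transferA s α₀ l p q - transferA s α₀ (l + 1) p q =
      ((if q = l then removedEntry s α₀ l p else 0) + if p = l then removedEntry s α₀ l q else 0) +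
      ((if q = l + 1 then (if l < p then removedEntry s α₀ l (p + 1) else 0) else 0) +
        if p = l + 1 then (if l < q then removedEntry s α₀ l (q + 1) else 0) else 0) := by
  wlog hpq : q ≤ p generalizing p q
  · rw [transferA_comm s α₀ l p q, transferA_comm s α₀ (l + 1) p q, this q p (by omega)]
    ring
  simp only [transferA, max_eq_left hpq, min_eq_right hpq, removedEntry]
  rcases lt_trichotomy q l with hq | rfl | hq
  · have : transferA s α₀ l p q = 0 := transferA_eq_zero_of_min_lt _ _ _ _ _ (by omega)
    grind
  · grind
  · have hbig : s < p + 1 → transferA s α₀ l (p + 1) l = 0 :=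
      transferA_eq_zero_of_lt _ _ _ _ _
    rcases Nat.lt_or_ge q (l + 2) with hq' | hq'
    · obtain rfl : q = l + 1 := by omega
      simp only [Nat.add_sub_cancel]
      grind
    · grind

/-- The new entries of `𝔹` are twice the removed entries, shifted by one row; on the diagonal the
two symmetric terms add up to that. -/
theorem transferB_succ_sub_transferB (s : ℕ) (α₀ : ℝ) (l p q : ℕ) :
    transferB s α₀ (l + 1) p q - transferB s α₀ l p q =
      (if q = l then
        (if l < p then 2 * removedEntry s α₀ l (p + 1)
          else if p = l then removedEntry s α₀ l (l + 1) else 0) else 0) +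
      if p = l then
        (if l < q then 2 * removedEntry s α₀ l (q + 1)
          else if q = l then removedEntry s α₀ l (l + 1) else 0) else 0 := by
  wlog hpq : q ≤ p generalizing p q
  · rw [transferB_comm s α₀ l p q, transferB_comm s α₀ (l + 1) p q, this q p (by omega)]
    ring
  simp only [transferB, max_eq_left hpq, min_eq_right hpq, removedEntry]
  have hbig : s < p + 1 → transferA s α₀ l (p + 1) l = 0 := transferA_eq_zero_of_lt _ _ _ _ _
  by_cases hq : q = l
  · subst hq
    have h0 : transferB s α₀ q p q = 0 := transferB_eq_zero_of_le_min _ _ _ _ _ (by omega)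
    grind
  · grind

theorem sum_sum_ite_symm (n l : ℕ) (hl : l < n) (g : ℕ → ℝ) (F : ℕ → ℕ → ℝ)
    (hF : ∀ p q, F p q = F q p) :
    ∑ p ∈ Finset.range n, ∑ q ∈ Finset.range n,
      ((if q = l then g p else 0) + if p = l then g q else 0) * F p q =
      2 * ∑ p ∈ Finset.range n, g p * F p l := by
  have hl' := Finset.mem_range.2 hl
  simp only [add_mul, ite_mul, zero_mul, Finset.sum_add_distrib, Finset.sum_ite_eq', hl', if_true]
  rw [Finset.sum_comm]
  simp only [Finset.sum_ite_eq', hl', if_true, hF l]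
  ring

section Energy

variable {V : Type*} [AddCommGroup V] [Module ℝ V]

/-- The form `-(E(Kv, w) + E(v, Kw))` that measures the dissipation of `K`. -/
noncomputable def dissipation (E : LinearMap.BilinForm ℝ V) (K : V →ₗ[ℝ] V) : LinearMap.BilinForm ℝ V :=
  -(E.compLeft K + E.compRight K)

theorem dissipation_apply (E : LinearMap.BilinForm ℝ V) (K : V →ₗ[ℝ] V) (v w : V) :
    dissipation E K v w = -(E (K v) w + E v (K w)) := by
  simp [dissipation]

/-- The energy `∑ a_{pq} E(D_p, D_q) - ½ ∑ b_{pq} S(D_p, D_q)` after `l` steps of the process,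
where `D_p = K^p u` and `S` is the dissipation form. -/
noncomputable def transferEnergy (s : ℕ) (α₀ : ℝ) (l : ℕ) (E : LinearMap.BilinForm ℝ V) (K : V →ₗ[ℝ] V)
    (u : V) : ℝ :=
  ∑ p ∈ Finset.range (s + 1), ∑ q ∈ Finset.range (s + 1),
      transferA s α₀ l p q * E ((K ^ p) u) ((K ^ q) u) -
    1 / 2 * ∑ p ∈ Finset.range (s + 1), ∑ q ∈ Finset.range (s + 1),
      transferB s α₀ l p q * dissipation E K ((K ^ p) u) ((K ^ q) u)

/-- As long as the process has not terminated, a step does not change the energy, since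
`E(D_{p+1}, D_l) + E(D_p, D_{l+1}) = -S(D_p, D_l)`. -/
theorem transferEnergy_succ (s : ℕ) (α₀ : ℝ) (l : ℕ) (hl : l < s)
    (h : transferA s α₀ l l l = 0) (E : LinearMap.BilinForm ℝ V) (hE : ∀ v w, E v w = E w v)
    (K : V →ₗ[ℝ] V) (u : V) :
    transferEnergy s α₀ (l + 1) E K u = transferEnergy s α₀ l E K u := by
  set D : ℕ → V := fun p => (K ^ p) u with hD
  have hKD : ∀ p, K (D p) = D (p + 1) := fun p => by
    simp only [hD, pow_succ', Module.End.mul_apply]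
  have hS : ∀ p q, dissipation E K (D p) (D q) = dissipation E K (D q) (D p) := by
    intro p q
    rw [dissipation_apply, dissipation_apply, hE (K (D p)), hE (D p)]
    ring
  have hA : ∑ p ∈ Finset.range (s + 1), ∑ q ∈ Finset.range (s + 1),
        (transferA s α₀ l p q - transferA s α₀ (l + 1) p q) * E (D p) (D q) =
      2 * ∑ p ∈ Finset.range (s + 1), removedEntry s α₀ l p * E (D p) (D l) +
      2 * ∑ p ∈ Finset.range (s + 1),
        (if l < p then removedEntry s α₀ l (p + 1) else 0) * E (D p) (D (l + 1)) := by
    rw [← sum_sum_ite_symm (s + 1) l (by omega) _ (fun p q => E (D p) (D q)) fun p q => hE _ _,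
      ← sum_sum_ite_symm (s + 1) (l + 1) (by omega) _ (fun p q => E (D p) (D q)) fun p q => hE _ _,
      ← Finset.sum_add_distrib]
    refine Finset.sum_congr rfl fun p _ => ?_
    rw [← Finset.sum_add_distrib]
    refine Finset.sum_congr rfl fun q _ => ?_
    rw [transferA_sub_transferA_succ s α₀ l p q h]
    ring
  have hB : ∑ p ∈ Finset.range (s + 1), ∑ q ∈ Finset.range (s + 1),
        (transferB s α₀ (l + 1) p q - transferB s α₀ l p q) * dissipation E K (D p) (D q) =
      2 * ∑ p ∈ Finset.range (s + 1), (if l < p then 2 * removedEntry s α₀ l (p + 1)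
          else if p = l then removedEntry s α₀ l (l + 1) else 0) *
            dissipation E K (D p) (D l) := by
    rw [← sum_sum_ite_symm (s + 1) l (by omega) _ (fun p q => dissipation E K (D p) (D q)) hS]
    refine Finset.sum_congr rfl fun p _ => Finset.sum_congr rfl fun q _ => ?_
    rw [transferB_succ_sub_transferB]
  -- index shift: the entry `0` is not removed and the entry `s + 1` vanishes
  have hshift : ∑ p ∈ Finset.range (s + 1), removedEntry s α₀ l p * E (D p) (D l) =
      ∑ p ∈ Finset.range (s + 1), removedEntry s α₀ l (p + 1) * E (D (p + 1)) (D l) := by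
    have h0 : removedEntry s α₀ l 0 = 0 := by simp [removedEntry]
    have h1 : removedEntry s α₀ l (s + 1) = 0 := by
      simp [removedEntry, transferA_eq_zero_of_lt]
    rw [Finset.sum_range_succ', Finset.sum_range_succ _ s, h0, h1]
    ring
  have hpt : ∀ p, 2 * (removedEntry s α₀ l (p + 1) * E (D (p + 1)) (D l)) +
      2 * ((if l < p then removedEntry s α₀ l (p + 1) else 0) * E (D p) (D (l + 1))) +
      (if l < p then 2 * removedEntry s α₀ l (p + 1)
          else if p = l then removedEntry s α₀ l (l + 1) else 0) *
            dissipation E K (D p) (D l) = 0 := by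
    intro p
    rw [dissipation_apply, hKD, hKD]
    rcases lt_trichotomy l p with hp | rfl | hp
    · simp only [hp, if_true]
      ring
    · simp only [lt_irrefl, if_false, if_true, hE (D l) (D (l + 1))]
      ring
    · have : removedEntry s α₀ l (p + 1) = 0 := by simp [removedEntry]; omega
      simp [this, hp.not_gt, hp.ne]
  rw [hshift] at hA
  have hzero := Finset.sum_eq_zero fun p (_ : p ∈ Finset.range (s + 1)) => hpt p
  simp only [Finset.sum_add_distrib, ← Finset.mul_sum] at hzero
  simp only [sub_mul, Finset.sum_sub_distrib] at hA hB
  simp only [transferEnergy]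
  linarith

end Energy

/-! ### The stage polynomials and the termination of the process -/

theorem natDegree_stagePoly_le (s l : ℕ) : (stagePoly s l).natDegree ≤ l := by
  induction l using Nat.strong_induction_on with
  | _ l ih =>
    cases l with
    | zero => simp [stagePoly]
    | succ l =>
      rw [stagePoly]
      refine natDegree_sum_le_of_forall_le _ _ fun κ _ => ?_
      refine natDegree_mul_le.trans ?_
      have h1 : (C (rkC s l κ) + C (rkD s l κ) * X).natDegree ≤ 1 := by
        rw [add_comm]
        exact natDegree_linear_le
      have h2 := ih κ κ.isLt
      have h3 := κ.isLt
      omega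

theorem coeff_stagePoly_succ (s l : ℕ) :
    (stagePoly s (l + 1)).coeff (l + 1) = rkD s l l * (stagePoly s l).coeff l := by
  rw [stagePoly, finsetSum_coeff, Fin.sum_univ_castSucc]
  have hlow : ∀ κ ≤ l, (stagePoly s κ).coeff (l + 1) = 0 := fun κ hκ =>
    coeff_eq_zero_of_natDegree_lt ((natDegree_stagePoly_le s κ).trans_lt (by omega))
  have hlow' : ∀ κ < l, (stagePoly s κ).coeff l = 0 := fun κ hκ =>
    coeff_eq_zero_of_natDegree_lt ((natDegree_stagePoly_le s κ).trans_lt (by omega))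
  have h : ∀ κ, ((C (rkC s l κ) + C (rkD s l κ) * X) * stagePoly s κ).coeff (l + 1) =
      rkC s l κ * (stagePoly s κ).coeff (l + 1) + rkD s l κ * (stagePoly s κ).coeff l := by
    intro κ
    rw [add_mul, coeff_add, coeff_C_mul, mul_assoc, coeff_C_mul, coeff_X_mul]
  simp only [h, Fin.val_castSucc, Fin.val_last]
  rw [Finset.sum_eq_zero, hlow l le_rfl]
  · ring
  · intro κ _
    rw [hlow κ κ.isLt.le, hlow' κ κ.isLt]
    ring

theorem sspG_self_pos (m : ℕ) : 0 < sspG m m := by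
  cases m with
  | zero => simp [sspG]
  | succ m =>
    simp [sspG]
    positivity

theorem sum_sspG (m : ℕ) : ∑ κ ∈ Finset.range (m + 1), sspG m κ = 1 := by
  cases m with
  | zero => simp [sspG]
  | succ m =>
    have hIcc : ∀ f : ℕ → ℝ, ∑ r ∈ Finset.Icc 1 (m + 1), f r =
        ∑ κ ∈ Finset.range (m + 1), f (κ + 1) := by
      intro f
      rw [Finset.range_eq_Ico, Finset.sum_Ico_add' f 0 (m + 1) 1]
      rfl
    rw [Finset.sum_range_succ']
    simp only [sspG, hIcc, if_true, Nat.add_eq_zero_iff, one_ne_zero, and_false, if_false]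
    exact add_sub_cancel _ _

theorem coeff_stagePoly_self_pos (s l : ℕ) : 0 < (stagePoly s l).coeff l := by
  induction l with
  | zero => simp [stagePoly]
  | succ l ih =>
    rw [coeff_stagePoly_succ]
    refine mul_pos ?_ ih
    rw [rkD, if_pos rfl]
    split_ifs
    · exact sspG_self_pos _
    · exact one_pos

theorem coeff_zero_stagePoly (s l : ℕ) (hl : l ≤ s) : (stagePoly s l).coeff 0 = 1 := by
  induction l using Nat.strong_induction_on with
  | _ l ih =>
    cases l with
    | zero => simp [stagePoly]
    | succ l =>
      rw [stagePoly, finsetSum_coeff]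
      have h : ∀ κ : Fin (l + 1), ((C (rkC s l κ) + C (rkD s l κ) * X) *
          stagePoly s κ).coeff 0 = rkC s l κ := by
        intro κ
        rw [mul_coeff_zero, ih κ κ.isLt (by have := κ.isLt; omega)]
        simp
      simp only [h]
      rw [Fin.sum_univ_eq_sum_range (fun κ => rkC s l κ)]
      by_cases hls : l + 1 = s
      · subst hls
        simp [rkC, sum_sspG]
      · simp [rkC, hls]

/-- A Runge–Kutta method in Shu–Osher form applied to a linear operator `K` is a polynomial
in `K`. -/
theorem eq_aeval_stagePoly {V : Type*} [AddCommGroup V] [Module ℝ V] (s : ℕ) (K : V →ₗ[ℝ] V)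
    (U : ℕ → V) (hU : ∀ l < s, U (l + 1) =
      ∑ κ ∈ Finset.range (l + 1), (rkC s l κ • U κ + rkD s l κ • K (U κ)))
    (l : ℕ) (hl : l ≤ s) : U l = aeval K (stagePoly s l) (U 0) := by
  induction l using Nat.strong_induction_on with
  | _ l ih =>
    cases l with
    | zero => simp [stagePoly]
    | succ l =>
      rw [hU l (by omega), stagePoly, map_sum, LinearMap.sum_apply,
        ← Fin.sum_univ_eq_sum_range (fun κ => rkC s l κ • U κ + rkD s l κ • K (U κ))]
      refine Finset.sum_congr rfl fun κ _ => ?_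
      rw [ih κ κ.isLt (by have := κ.isLt; omega)]
      simp [Module.algebraMap_end_apply]

/-- The corner entry `(s, s)` is not changed by the process, so it terminates at step `s` at the
latest. -/
theorem transferA_last_ne_zero (s : ℕ) (hs : 1 ≤ s) (α₀ : ℝ) (hα₀ : 0 < α₀) :
    transferA s α₀ s s s ≠ 0 := by
  have h : ∀ l < s, transferA s α₀ l s s = evolutionCoeff s α₀ s * evolutionCoeff s α₀ s := by
    intro l hl
    induction l with
    | zero => simp [transferA, initialA]; omega
    | succ l ih =>
      simp only [transferA, max_self, min_self]
      rw [if_neg (by omega), if_neg (by omega), if_neg (by omega), ih (by omega)]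
  obtain ⟨m, rfl⟩ : ∃ m, s = m + 1 := ⟨s - 1, by omega⟩
  simp only [transferA, max_self, min_self]
  rw [if_neg (by omega), if_pos (by simp), h m (by omega),
    transferA_eq_zero_of_lt _ _ _ (m + 1 + 1) _ (by omega)]
  have hpos : 0 < evolutionCoeff (m + 1) α₀ (m + 1) :=
    mul_pos hα₀ (coeff_stagePoly_self_pos (m + 1) (m + 1))
  rw [mul_zero, sub_zero]
  exact (mul_pos hpos hpos).ne'

theorem terminationIndex_spec (s : ℕ) (hs : 1 ≤ s) (α₀ : ℝ) (hα₀ : 0 < α₀) :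
    1 ≤ terminationIndex s α₀ ∧ terminationIndex s α₀ ≤ s ∧
      transferA s α₀ (terminationIndex s α₀) (terminationIndex s α₀) (terminationIndex s α₀) ≠ 0 :=
  Nat.sInf_mem (s := {l : ℕ | 1 ≤ l ∧ l ≤ s ∧ transferA s α₀ l l l ≠ 0})
    ⟨s, hs, le_rfl, transferA_last_ne_zero s hs α₀ hα₀⟩

theorem transferA_diag_eq_zero (s : ℕ) (α₀ : ℝ) (l : ℕ) (hls : l ≤ s)
    (hl : l < terminationIndex s α₀) : transferA s α₀ l l l = 0 := by
  rcases Nat.eq_zero_or_pos l with rfl | hl0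
  · simp [transferA, initialA]
  · by_contra h
    exact Nat.notMem_of_lt_sInf hl ⟨hl0, hls, h⟩

theorem contributionIndex_le (s : ℕ) (α₀ : ℝ) :
    contributionIndex s α₀ ≤ terminationIndex s α₀ := by
  unfold contributionIndex
  split_ifs with h
  · exact (Nat.sInf_mem h).1.le
  · exact le_rfl

theorem det_leadingBlock_pos (s : ℕ) (α₀ : ℝ) (κ : ℕ) (hκ : κ < contributionIndex s α₀) :
    0 < (leadingBlock (transferB s α₀ (terminationIndex s α₀)) (κ + 1)).det := by
  have hκ' := hκ.trans_le (contributionIndex_le s α₀)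
  by_contra! h
  have hmem : κ ∈ nonposMinors s α₀ := ⟨hκ', h⟩
  rw [contributionIndex, if_pos ⟨κ, hmem⟩] at hκ
  exact Nat.notMem_of_lt_sInf hκ hmem

/-! ### One step with a dissipative operator of small norm -/

section Energy

variable {V : Type*} [AddCommGroup V] [Module ℝ V]

/-- Before the process starts, the energy is the scaled increment of the squared norm. -/
theorem transferEnergy_zero (s : ℕ) (α₀ : ℝ) (E : LinearMap.BilinForm ℝ V) (K : V →ₗ[ℝ] V)
    (u : V) :
    transferEnergy s α₀ 0 E K u = α₀ ^ 2 *
      (E (aeval K (stagePoly s s) u) (aeval K (stagePoly s s) u) - E u u) := by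
  have hcoeff : aeval K (stagePoly s s) u
      = ∑ p ∈ Finset.range (s + 1), (stagePoly s s).coeff p • (K ^ p) u := by
    rw [aeval_eq_sum_range' (Nat.lt_succ_of_le (natDegree_stagePoly_le s s))]
    simp
  have hinit : ∀ p ∈ Finset.range (s + 1), ∀ q ∈ Finset.range (s + 1),
      transferA s α₀ 0 p q * E ((K ^ p) u) ((K ^ q) u) =
        α₀ ^ 2 * ((stagePoly s s).coeff p * ((stagePoly s s).coeff q *
          E ((K ^ p) u) ((K ^ q) u))) -
        if p = 0 then (if q = 0 then α₀ ^ 2 * E u u else 0) else 0 := by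
    intro p hp q hq
    rw [Finset.mem_range] at hp hq
    simp only [transferA, initialA, evolutionCoeff]
    by_cases hpq : p = 0 ∧ q = 0
    · obtain ⟨rfl, rfl⟩ := hpq
      simp [coeff_zero_stagePoly s s le_rfl]
    · rw [if_pos (by omega)]
      have : (if p = 0 then (if q = 0 then α₀ ^ 2 * E u u else 0) else 0) = 0 := by
        split_ifs <;> tauto
      rw [this]
      ring
  rw [transferEnergy, Finset.sum_congr rfl fun p hp => Finset.sum_congr rfl (hinit p hp), hcoeff]
  simp only [map_sum, LinearMap.sum_apply, map_smul, LinearMap.smul_apply, smul_eq_mul]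
  simp only [Finset.sum_sub_distrib, ← Finset.mul_sum, transferB]
  simp
  rw [mul_sub]
  congr 2
  simp only [Finset.mul_sum]
  rw [Finset.sum_comm]
  refine Finset.sum_congr rfl fun p _ => Finset.sum_congr rfl fun q _ => ?_
  ring

theorem transferEnergy_terminationIndex (s : ℕ) (hs : 1 ≤ s) (α₀ : ℝ) (hα₀ : 0 < α₀)
    (E : LinearMap.BilinForm ℝ V) (hE : ∀ v w, E v w = E w v) (K : V →ₗ[ℝ] V) (u : V) :
    transferEnergy s α₀ (terminationIndex s α₀) E K u = α₀ ^ 2 *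
      (E (aeval K (stagePoly s s) u) (aeval K (stagePoly s s) u) - E u u) := by
  have hζ := (terminationIndex_spec s hs α₀ hα₀).2.1
  have h : ∀ l ≤ terminationIndex s α₀,
      transferEnergy s α₀ l E K u = transferEnergy s α₀ 0 E K u := by
    intro l hl
    induction l with
    | zero => rfl
    | succ l ih =>
      rw [transferEnergy_succ s α₀ l (by omega)
        (transferA_diag_eq_zero s α₀ l (by omega) (by omega)) E hE, ih (by omega)]
  rw [h _ le_rfl, transferEnergy_zero]

/-- The weighted Cauchy–Schwarz inequality for two vectors of squared lengths `e` and `μ² e`. -/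
theorem bilin_le_of_scale (E : LinearMap.BilinForm ℝ V) (hE : ∀ v w, E v w = E w v)
    (hpos : ∀ v, 0 ≤ E v v) {μ e : ℝ} (hμ : 0 < μ) {v w : V} (hv : E v v ≤ e)
    (hw : E w w ≤ μ ^ 2 * e) : |E v w| ≤ μ * e := by
  have key : ∀ t : ℝ, 0 ≤ E w w + 2 * t * E v w + t ^ 2 * E v v := by
    intro t
    have := hpos (w + t • v)
    simp only [map_add, LinearMap.add_apply, map_smul, LinearMap.smul_apply, smul_eq_mul,
      hE w v] at this
    linarith
  have hv' := mul_le_mul_of_nonneg_left hv (sq_nonneg μ)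
  rw [abs_le]
  constructor
  · have := key μ
    nlinarith
  · have := key (-μ)
    nlinarith

variable (E : LinearMap.BilinForm ℝ V) (K : V →ₗ[ℝ] V) {μ : ℝ}

theorem pow_apply_le (hK : ∀ v, E (K v) (K v) ≤ μ ^ 2 * E v v) (p j : ℕ)
    (u : V) : E ((K ^ (p + j)) u) ((K ^ (p + j)) u) ≤ (μ ^ 2) ^ j * E ((K ^ p) u) ((K ^ p) u) := by
  induction j with
  | zero => simp
  | succ j ih =>
    rw [← add_assoc, pow_succ' K, Module.End.mul_apply, pow_succ' (μ ^ 2), mul_assoc]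
    exact (hK _).trans (mul_le_mul_of_nonneg_left ih (sq_nonneg μ))

theorem pow_apply_le_of_le (hpos : ∀ v, 0 ≤ E v v) (hμ : 0 < μ) (hμ1 : μ ≤ 1)
    (hK : ∀ v, E (K v) (K v) ≤ μ ^ 2 * E v v) {p q : ℕ} (hpq : p ≤ q) (u : V) :
    E ((K ^ q) u) ((K ^ q) u) ≤ E ((K ^ p) u) ((K ^ p) u) := by
  obtain ⟨j, rfl⟩ := Nat.exists_eq_add_of_le hpq
  refine (pow_apply_le E K hK p j u).trans (mul_le_of_le_one_left (hpos _) ?_)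
  exact pow_le_one₀ (sq_nonneg μ) (pow_le_one₀ hμ.le hμ1)

theorem pow_apply_le_of_lt (hpos : ∀ v, 0 ≤ E v v) (hμ : 0 < μ) (hμ1 : μ ≤ 1)
    (hK : ∀ v, E (K v) (K v) ≤ μ ^ 2 * E v v) {p q : ℕ} (hpq : p < q) (u : V) :
    E ((K ^ q) u) ((K ^ q) u) ≤ μ ^ 2 * E ((K ^ p) u) ((K ^ p) u) := by
  refine (pow_apply_le_of_le E K hpos hμ hμ1 hK hpq u).trans ?_
  simpa using pow_apply_le E K hK p 1 u

theorem dissipation_le (hE : ∀ v w, E v w = E w v) (hpos : ∀ v, 0 ≤ E v v) (hμ : 0 < μ)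
    (hK : ∀ v, E (K v) (K v) ≤ μ ^ 2 * E v v) (v : V) : dissipation E K v v ≤ 2 * μ * E v v := by
  have := (abs_le.1 (bilin_le_of_scale E hE hpos hμ le_rfl (hK v))).1
  rw [dissipation_apply, hE (K v) v]
  linarith

end Energy

/-- The energy estimate at termination: the first term collects the entries of `𝔸^{(ζ)}`, and the
second one bounds the entries of `𝔹^{(ζ)}` outside its positive definite leading block. -/
theorem exists_energy_estimate (s : ℕ) (hs : 1 ≤ s) (α₀ : ℝ) (hα₀ : 0 < α₀) (ζ ρ : ℕ)
    (hζ : ζ = terminationIndex s α₀) (hρ : ρ = contributionIndex s α₀) :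
    ∃ c : ℝ, 0 ≤ c ∧ ∀ (V : Type) [AddCommGroup V] [Module ℝ V] (E : LinearMap.BilinForm ℝ V)
      (K : V →ₗ[ℝ] V) (μ : ℝ), (∀ v w, E v w = E w v) → (∀ v, 0 ≤ E v v) →
      (∀ v, E (K v) v ≤ 0) → 0 < μ → μ ≤ 1 → (∀ v, E (K v) (K v) ≤ μ ^ 2 * E v v) → ∀ u,
        α₀ ^ 2 * (E (aeval K (stagePoly s s) u) (aeval K (stagePoly s s) u) - E u u) ≤
          (transferA s α₀ ζ ζ ζ + c * μ) * E ((K ^ ζ) u) ((K ^ ζ) u) +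
            c * μ * E ((K ^ ρ) u) ((K ^ ρ) u) := by
  have hζs : ζ ≤ s := hζ ▸ (terminationIndex_spec s hs α₀ hα₀).2.1
  have hρζ : ρ ≤ ζ := hζ ▸ hρ ▸ contributionIndex_le s α₀
  obtain ⟨c₁, hc₁, hB⟩ := exists_leading_lower_bound (transferB s α₀ ζ) (transferB_comm s α₀ ζ) ρ
    (s + 1) (by omega) (by subst hζ hρ; exact det_leadingBlock_pos s α₀)
  set c₂ : ℝ := ∑ p ∈ Finset.range (s + 1), ∑ q ∈ Finset.range (s + 1), |transferA s α₀ ζ p q|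
  have hc₂ : 0 ≤ c₂ := by positivity
  refine ⟨c₂ + c₁ * (s + 1), by positivity, fun V _ _ E K μ hE hpos hdiss hμ hμ1 hK u => ?_⟩
  set D : ℕ → V := fun p => (K ^ p) u with hD
  have hSpos : ∀ v, 0 ≤ dissipation E K v v := fun v => by
    rw [dissipation_apply, hE v]
    linarith [hdiss v]
  have hS : ∑ p ∈ Finset.Ico ρ (s + 1), dissipation E K (D p) (D p) ≤
      (s + 1) * (2 * μ * E (D ρ) (D ρ)) := by
    calc _ ≤ ∑ p ∈ Finset.Ico ρ (s + 1), 2 * μ * E (D ρ) (D ρ) := by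
          refine Finset.sum_le_sum fun p hp => (dissipation_le E K hE hpos hμ hK _).trans ?_
          have := pow_apply_le_of_le E K hpos hμ hμ1 hK (Finset.mem_Ico.1 hp).1 u
          gcongr
      _ ≤ _ := by
          rw [Finset.sum_const, nsmul_eq_mul, Nat.card_Ico]
          have := hpos (D ρ)
          gcongr
          exact_mod_cast Nat.sub_le _ _
  have hA : ∑ p ∈ Finset.range (s + 1), ∑ q ∈ Finset.range (s + 1),
        transferA s α₀ ζ p q * E (D p) (D q) ≤
      (transferA s α₀ ζ ζ ζ + c₂ * μ) * E (D ζ) (D ζ) := by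
    have hmem : ζ ∈ Finset.range (s + 1) := Finset.mem_range.2 (by omega)
    have hrhs : (transferA s α₀ ζ ζ ζ + c₂ * μ) * E (D ζ) (D ζ) =
        ∑ p ∈ Finset.range (s + 1), ∑ q ∈ Finset.range (s + 1),
          ((if p = ζ then (if q = ζ then transferA s α₀ ζ ζ ζ * E (D ζ) (D ζ) else 0) else 0) +
            |transferA s α₀ ζ p q| * (μ * E (D ζ) (D ζ))) := by
      simp only [Finset.sum_add_distrib, ← Finset.sum_mul]
      rw [Finset.sum_eq_single_of_mem ζ hmem (fun p _ hp => by simp [hp])]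
      simp only [if_true, Finset.sum_ite_eq', hmem]
      simp only [c₂]
      ring
    rw [hrhs]
    refine Finset.sum_le_sum fun p _ => Finset.sum_le_sum fun q _ => ?_
    by_cases hpq : p = ζ ∧ q = ζ
    · have := hpos (D ζ)
      simp only [hpq.1, hpq.2, if_true]
      have : 0 ≤ |transferA s α₀ ζ ζ ζ| * (μ * E (D ζ) (D ζ)) := by positivity
      linarith
    · have h0 : (if p = ζ then (if q = ζ then transferA s α₀ ζ ζ ζ * E (D ζ) (D ζ) else 0)
          else 0) = 0 := by split_ifs <;> tauto
      rw [h0, zero_add]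
      by_cases hmin : min p q < ζ
      · simp [transferA_eq_zero_of_min_lt s α₀ ζ p q hmin]
      -- both indices are at least `ζ` and one of them is larger, which gains a factor `μ`
      have hEpq : |E (D p) (D q)| ≤ μ * E (D ζ) (D ζ) := by
        rcases Nat.lt_or_ge ζ q with hq | hq
        · exact bilin_le_of_scale E hE hpos hμ
            (pow_apply_le_of_le E K hpos hμ hμ1 hK (by omega) u)
            (pow_apply_le_of_lt E K hpos hμ hμ1 hK hq u)
        · rw [hE]
          exact bilin_le_of_scale E hE hpos hμ
            (pow_apply_le_of_le E K hpos hμ hμ1 hK (by omega) u)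
            (pow_apply_le_of_lt E K hpos hμ hμ1 hK (by omega) u)
      calc _ ≤ |transferA s α₀ ζ p q * E (D p) (D q)| := le_abs_self _
        _ ≤ _ := by rw [abs_mul]; gcongr
  have hBD := hB V (dissipation E K) hSpos D
  have hEζ := hpos (D ζ)
  have hEρ := hpos (D ρ)
  have hS' := mul_le_mul_of_nonneg_left hS hc₁
  have e1 : 0 ≤ c₁ * (s + 1) * μ * E (D ζ) (D ζ) := by positivity
  have e2 : 0 ≤ c₂ * μ * E (D ρ) (D ρ) := by positivity
  rw [← transferEnergy_terminationIndex s hs α₀ hα₀ E hE K u, ← hζ, transferEnergy]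
  simp only [hD] at *
  linarith

/-- The growth of one step of the Runge–Kutta method for a dissipative operator `K` of norm at most
`μ`, in the three cases of the process. -/
theorem exists_stability_constant (s : ℕ) (hs : 1 ≤ s) (α₀ : ℝ) (hα₀ : 0 < α₀) (ζ ρ : ℕ)
    (hζ : ζ = terminationIndex s α₀) (hρ : ρ = contributionIndex s α₀) :
    ∃ c μ₀ : ℝ, 0 < c ∧ 0 < μ₀ ∧ ∀ (V : Type) [AddCommGroup V] [Module ℝ V]
      (E : LinearMap.BilinForm ℝ V) (K : V →ₗ[ℝ] V) (μ : ℝ), (∀ v w, E v w = E w v) →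
      (∀ v, 0 ≤ E v v) → (∀ v, E (K v) v ≤ 0) → 0 < μ → μ ≤ μ₀ →
      (∀ v, E (K v) (K v) ≤ μ ^ 2 * E v v) → ∀ u u' : V, u' = aeval K (stagePoly s s) u →
        (transferA s α₀ ζ ζ ζ < 0 → ρ = ζ → E u' u' ≤ E u u) ∧
        (transferA s α₀ ζ ζ ζ < 0 → E u' u' ≤ (1 + c * μ ^ (2 * ρ + 1)) * E u u) ∧
        E u' u' ≤ (1 + c * μ ^ min (2 * ζ) (2 * ρ + 1)) * E u u := by
  obtain ⟨c, hc, hest⟩ := exists_energy_estimate s hs α₀ hα₀ ζ ρ hζ hρ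
  set a := transferA s α₀ ζ ζ ζ
  have ha : a ≠ 0 := by
    simp only [a]
    rw [hζ]
    exact (terminationIndex_spec s hs α₀ hα₀).2.2
  have ha' : 0 < |a| := abs_pos.2 ha
  have hα2 : 0 < α₀ ^ 2 := by positivity
  -- `μ₀` is small enough that `2 c μ ≤ |a|`, so that a negative `a` absorbs the error terms
  refine ⟨(|a| + 2 * c) / α₀ ^ 2, min 1 (|a| / (2 * c + 1)), by positivity, by positivity, ?_⟩
  rintro V _ _ E K μ hE hpos hdiss hμ hμ₀ hK u u' rfl
  have hμ1 : μ ≤ 1 := hμ₀.trans (min_le_left _ _)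
  have hcμ : 2 * (c * μ) ≤ |a| := by
    have := hμ₀.trans (min_le_right _ _)
    rw [le_div_iff₀ (by positivity)] at this
    nlinarith
  have key := hest V E K μ hE hpos hdiss hμ hμ1 hK u
  set x := E (aeval K (stagePoly s s) u) (aeval K (stagePoly s s) u)
  have hu := hpos u
  have hζpos := hpos ((K ^ ζ) u)
  have hρpos := hpos ((K ^ ρ) u)
  have hpow : ∀ p, E ((K ^ p) u) ((K ^ p) u) ≤ μ ^ (2 * p) * E u u := by
    intro p
    simpa [pow_mul] using pow_apply_le E K hK 0 p u
  have hρ1 : c * μ * E ((K ^ ρ) u) ((K ^ ρ) u) ≤ c * μ ^ (2 * ρ + 1) * E u u := by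
    calc _ ≤ c * μ * (μ ^ (2 * ρ) * E u u) := by gcongr; exact hpow ρ
      _ = _ := by ring
  have hfin : ∀ d : ℝ, 0 ≤ d → α₀ ^ 2 * (x - E u u) ≤ (|a| + 2 * c) * d * E u u →
      x ≤ (1 + (|a| + 2 * c) / α₀ ^ 2 * d) * E u u := by
    intro d _ h
    have : x - E u u ≤ (|a| + 2 * c) * d * E u u / α₀ ^ 2 := by
      rw [le_div_iff₀ hα2]
      linarith
    calc x ≤ E u u + (|a| + 2 * c) * d * E u u / α₀ ^ 2 := by linarith
      _ = _ := by ring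
  refine ⟨fun hneg hρζ => ?_, fun hneg => hfin _ (by positivity) ?_, hfin _ (by positivity) ?_⟩
  · subst hρζ
    rw [abs_of_neg hneg] at hcμ
    have : α₀ ^ 2 * (x - E u u) ≤ 0 := by nlinarith
    nlinarith
  · rw [abs_of_neg hneg] at hcμ
    have h1 : (a + c * μ) * E ((K ^ ζ) u) ((K ^ ζ) u) ≤ 0 :=
      mul_nonpos_of_nonpos_of_nonneg (by nlinarith) hζpos
    have h2 : 0 ≤ (|a| + c) * μ ^ (2 * ρ + 1) * E u u := by positivity
    linarith
  · have h1 : (a + c * μ) * E ((K ^ ζ) u) ((K ^ ζ) u) ≤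
        (|a| + c) * (μ ^ min (2 * ζ) (2 * ρ + 1) * E u u) := by
      have hm : μ ^ (2 * ζ) ≤ μ ^ min (2 * ζ) (2 * ρ + 1) :=
        pow_le_pow_of_le_one hμ.le hμ1 (min_le_left _ _)
      calc _ ≤ (|a| + c) * E ((K ^ ζ) u) ((K ^ ζ) u) := by
            gcongr
            · exact le_abs_self a
            · exact mul_le_of_le_one_right hc hμ1
        _ ≤ (|a| + c) * (μ ^ (2 * ζ) * E u u) := by gcongr; exact hpow ζ
        _ ≤ _ := by gcongr
    have h2 : c * μ ^ (2 * ρ + 1) * E u u ≤ c * μ ^ min (2 * ζ) (2 * ρ + 1) * E u u := by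
      have hm : μ ^ (2 * ρ + 1) ≤ μ ^ min (2 * ζ) (2 * ρ + 1) :=
        pow_le_pow_of_le_one hμ.le hμ1 (min_le_right _ _)
      gcongr
    linarith

/-! ### Legendre polynomials and quadrature on the reference element -/

/-- The integral of a polynomial over `[-1,1]`. -/
noncomputable def polyIntegral : ℝ[X] →ₗ[ℝ] ℝ where
  toFun p := ∫ t in (-1 : ℝ)..1, p.eval t
  map_add' p q := by
    simp only [eval_add]
    exact intervalIntegral.integral_add (p.continuous.intervalIntegrable _ _)
      (q.continuous.intervalIntegrable _ _)
  map_smul' c p := by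
    simp only [eval_smul, smul_eq_mul, RingHom.id_apply]
    exact intervalIntegral.integral_const_mul _ _

theorem polyIntegral_apply (p : ℝ[X]) : polyIntegral p = ∫ t in (-1 : ℝ)..1, p.eval t := rfl

theorem integral_eval_derivative (p : ℝ[X]) (a b : ℝ) :
    ∫ t in a..b, (derivative p).eval t = p.eval b - p.eval a :=
  intervalIntegral.integral_eq_sub_of_hasDerivAt (fun t _ => p.hasDerivAt t)
    ((derivative p).continuous.intervalIntegrable _ _)

theorem polyIntegral_derivative_mul (p q : ℝ[X]) :
    polyIntegral (derivative p * q) =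
      p.eval 1 * q.eval 1 - p.eval (-1) * q.eval (-1) - polyIntegral (p * derivative q) := by
  have h := integral_eval_derivative (p * q) (-1) 1
  rw [derivative_mul, ← polyIntegral_apply, map_add, eval_mul, eval_mul] at h
  linarith

theorem polyIntegral_self_nonneg (p : ℝ[X]) : 0 ≤ polyIntegral (p * p) := by
  rw [polyIntegral_apply]
  refine intervalIntegral.integral_nonneg (by norm_num) fun t _ => ?_
  rw [eval_mul]
  exact mul_self_nonneg _

theorem eq_zero_of_polyIntegral_self_eq_zero (p : ℝ[X]) (h : polyIntegral (p * p) = 0) :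
    p = 0 := by
  by_contra hp
  have hpos : 0 < polyIntegral (p * p) := by
    rw [polyIntegral_apply]
    obtain ⟨x, hx, hx0⟩ : ∃ x ∈ Set.Icc (-1 : ℝ) 1, p.eval x ≠ 0 := by
      by_contra! hall
      exact hp (p.eq_zero_of_infinite_isRoot
        ((Set.Icc_infinite (by norm_num : (-1 : ℝ) < 1)).mono fun x hx => hall x hx))
    refine intervalIntegral.integral_pos (by norm_num) (p * p).continuous.continuousOn
      (fun t _ => by rw [eval_mul]; exact mul_self_nonneg _) ⟨x, hx, ?_⟩
    rw [eval_mul]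
    exact mul_self_pos.2 hx0
  exact hpos.ne' h

theorem eval_iterate_derivative_eq_zero (n m : ℕ) (h : m < n) (x : ℝ) (hx : x ^ 2 = 1) :
    (derivative^[m] ((X ^ 2 - 1 : ℝ[X]) ^ n)).eval x = 0 := by
  have hdvd := pow_sub_dvd_iterate_derivative_pow (X ^ 2 - 1 : ℝ[X]) n m
  have hroot : (X ^ 2 - 1 : ℝ[X]) ∣ derivative^[m] ((X ^ 2 - 1 : ℝ[X]) ^ n) :=
    (dvd_pow_self _ (by omega)).trans hdvd
  obtain ⟨q, hq⟩ := hroot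
  rw [hq, eval_mul]
  simp [hx]

theorem polyIntegral_iterate_derivative_mul (n m : ℕ) (h : m ≤ n) (q : ℝ[X]) :
    polyIntegral (derivative^[m] ((X ^ 2 - 1 : ℝ[X]) ^ n) * q) =
      (-1) ^ m * polyIntegral ((X ^ 2 - 1 : ℝ[X]) ^ n * derivative^[m] q) := by
  induction m generalizing q with
  | zero => simp
  | succ m ih =>
    rw [Function.iterate_succ_apply', polyIntegral_derivative_mul, ih (by omega),
      eval_iterate_derivative_eq_zero n m (by omega) 1 (by norm_num),
      eval_iterate_derivative_eq_zero n m (by omega) (-1) (by norm_num), pow_succ,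
      ← Function.iterate_succ_apply]
    ring

/-- Orthogonality of the Legendre polynomial, by `n` integrations by parts. -/
theorem polyIntegral_legendre_mul (n : ℕ) (q : ℝ[X]) (hq : q.degree < n) :
    polyIntegral (legendre n * q) = 0 := by
  rw [legendre, mul_assoc, ← smul_eq_C_mul, map_smul,
    polyIntegral_iterate_derivative_mul n n le_rfl,
    iterate_derivative_eq_zero_of_degree_lt hq]
  simp

/-- The value at `1` is read off the Taylor coefficient of order `n` of
`(X² - 1)ⁿ = (X - 1)ⁿ (X + 1)ⁿ`. -/
theorem eval_one_legendre (n : ℕ) : (legendre n).eval 1 = 1 := by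
  have h : (derivative^[n] ((X ^ 2 - 1 : ℝ[X]) ^ n)).eval 1 = n.factorial * 2 ^ n := by
    have h1 : (taylor (1 : ℝ) ((X ^ 2 - 1) ^ n)).coeff n = 2 ^ n := by
      have : taylor (1 : ℝ) ((X ^ 2 - 1) ^ n) = (X + C 2) ^ n * X ^ n := by
        rw [taylor_apply, pow_comp, ← mul_pow]
        congr 1
        simp only [sub_comp, pow_comp, X_comp, one_comp]
        rw [show (C 2 : ℝ[X]) = 2 from rfl, show (C 1 : ℝ[X]) = 1 from rfl]
        ring
      rw [this]
      have := coeff_mul_X_pow ((X + C (2 : ℝ)) ^ n) n 0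
      rw [zero_add] at this
      rw [this, coeff_zero_eq_eval_zero]
      simp
    rw [taylor_coeff] at h1
    rw [← factorial_smul_hasseDeriv, ← h1]
    simp
  rw [legendre, eval_mul, eval_C, h]
  field_simp

theorem natDegree_legendre_le (n : ℕ) : (legendre n).natDegree ≤ n := by
  rw [legendre]
  refine (natDegree_C_mul_le _ _).trans ((natDegree_iterate_derivative _ _).trans ?_)
  have h : ((X ^ 2 - 1 : ℝ[X]) ^ n).natDegree ≤ n * 2 := by
    refine natDegree_pow_le_of_le n ?_
    compute_degree
  omega

theorem degree_legendre_lt (n : ℕ) : (legendre n).degree < (n + 1 : ℕ) :=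
  degree_le_natDegree.trans_lt (Nat.cast_lt.2 (Nat.lt_succ_of_le (natDegree_legendre_le n)))

theorem legendre_ne_zero (n : ℕ) : legendre n ≠ 0 := fun h => by
  simpa [h] using eval_one_legendre n

/-- Two consecutive Legendre polynomials differ, since they are orthogonal and nonzero. -/
theorem nodePoly_ne_zero (kind : SVKind) (k : ℕ) : nodePoly kind k ≠ 0 := by
  cases kind with
  | LSV => exact legendre_ne_zero k
  | RRSV =>
    intro h
    refine legendre_ne_zero k (eq_zero_of_polyIntegral_self_eq_zero _ ?_)
    nth_rw 1 [← sub_eq_zero.1 h]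
    exact polyIntegral_legendre_mul _ _ (degree_legendre_lt k)

theorem polyIntegral_nodePoly_mul (kind : SVKind) (k : ℕ) (q : ℝ[X]) (hq : q.degree < k) :
    polyIntegral (nodePoly kind k * q) = 0 := by
  cases kind with
  | LSV => exact polyIntegral_legendre_mul k q hq
  | RRSV =>
    simp only [nodePoly]
    rw [sub_mul, map_sub, polyIntegral_legendre_mul k q hq,
      polyIntegral_legendre_mul (k + 1) q (hq.trans (by exact_mod_cast Nat.lt_succ_self k)),
      sub_zero]

section Quadrature

variable {kind : SVKind} {k : ℕ} {y : Fin (k + 2) → ℝ}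

theorem card_quadNodes (kind : SVKind) (k : ℕ) : (quadNodes kind k).card =
    match kind with
    | SVKind.LSV => k
    | SVKind.RRSV => k + 1 := by
  cases kind with
  | LSV =>
    have : quadNodes SVKind.LSV k = (Finset.univ.erase 0).erase (Fin.last (k + 1)) := by
      ext j
      simp [quadNodes, and_comm]
    simp only [this]
    rw [Finset.card_erase_of_mem (by simp [Fin.ext_iff]), Finset.card_erase_of_mem (by simp)]
    simp
  | RRSV =>
    have : quadNodes SVKind.RRSV k = Finset.univ.erase 0 := by
      ext j
      simp [quadNodes]
    simp only [this]
    rw [Finset.card_erase_of_mem (by simp)]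
    simp

theorem le_card_quadNodes (kind : SVKind) (k : ℕ) : k ≤ (quadNodes kind k).card := by
  rw [card_quadNodes]
  cases kind <;> simp

theorem natDegree_nodePoly_le (kind : SVKind) (k : ℕ) :
    (nodePoly kind k).natDegree ≤ (quadNodes kind k).card := by
  rw [card_quadNodes]
  cases kind with
  | LSV => exact natDegree_legendre_le k
  | RRSV =>
    exact (natDegree_sub_le_of_le (natDegree_legendre_le (k + 1))
      ((natDegree_legendre_le k).trans (Nat.le_succ k))).trans (max_self _).le

/-- The monic polynomial vanishing at the quadrature nodes. -/
noncomputable def nodal (kind : SVKind) (k : ℕ) (y : Fin (k + 2) → ℝ) : ℝ[X] :=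
  Lagrange.nodal (quadNodes kind k) y

theorem isRoot_nodePoly (hy : IsSubdivision kind k y) (j : Fin (k + 2))
    (hj : j ∈ quadNodes kind k) : (nodePoly kind k).IsRoot (y j) := by
  cases kind with
  | LSV =>
    simp only [quadNodes, Finset.mem_filter, Finset.mem_univ, true_and] at hj
    exact hy.root j hj.1 hj.2
  | RRSV =>
    simp only [quadNodes, Finset.mem_filter, Finset.mem_univ, true_and] at hj
    by_cases hlast : j = Fin.last (k + 1)
    · rw [hlast, hy.last]
      simp [nodePoly, eval_one_legendre]
    · exact hy.root j hj hlast

/-- The nodal polynomial divides `nodePoly` and has at least its degree, so it inherits the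
orthogonality. -/
theorem polyIntegral_nodal_mul (hy : IsSubdivision kind k y) (q : ℝ[X]) (hq : q.degree < k) :
    polyIntegral (nodal kind k y * q) = 0 := by
  have hdvd : nodal kind k y ∣ nodePoly kind k := by
    rw [nodal, Lagrange.nodal_eq]
    refine Finset.prod_dvd_of_coprime ?_ fun j hj => dvd_iff_isRoot.2 (isRoot_nodePoly hy j hj)
    exact fun i _ j _ hij => pairwise_coprime_X_sub_C hy.strictMono.injective hij
  have hR := nodePoly_ne_zero kind k
  have hdeg : (nodePoly kind k).natDegree ≤ (nodal kind k y).natDegree := by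
    rw [nodal, Lagrange.natDegree_nodal]
    exact natDegree_nodePoly_le kind k
  obtain ⟨g, hg⟩ := hdvd
  have hg0 : g ≠ 0 := by
    rintro rfl
    exact hR (by simpa using hg)
  have hgdeg : g.natDegree = 0 := by
    have hΩ : nodal kind k y ≠ 0 := Lagrange.nodal_ne_zero
    rw [hg, natDegree_mul hΩ hg0] at hdeg
    omega
  obtain ⟨c, rfl⟩ := natDegree_eq_zero.1 hgdeg
  have hc : c ≠ 0 := by
    rintro rfl
    simp at hg0
  have h := polyIntegral_nodePoly_mul kind k q hq
  rw [hg, mul_comm (nodal kind k y), mul_assoc, ← smul_eq_C_mul, map_smul, smul_eq_mul] at h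
  exact (mul_eq_zero.1 h).resolve_left hc

/-- The quadrature rule `∑ A_j f(y_j)`. -/
noncomputable def quadrature (kind : SVKind) (k : ℕ) (y : Fin (k + 2) → ℝ) (f : ℝ[X]) : ℝ :=
  ∑ j, quadWeight kind k y j * f.eval (y j)

theorem quadrature_eq_of_degree_lt (hy : IsSubdivision kind k y) (f : ℝ[X])
    (hf : f.degree < (quadNodes kind k).card) : quadrature kind k y f = polyIntegral f := by
  have hinj : Set.InjOn y (quadNodes kind k) := hy.strictMono.injective.injOn
  conv_rhs => rw [Lagrange.eq_interpolate hinj hf, Lagrange.interpolate_apply]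
  simp only [map_sum, quadrature, quadWeight, ite_mul, zero_mul, ← smul_eq_C_mul, map_smul,
    smul_eq_mul, polyIntegral_apply]
  rw [Finset.sum_ite_mem, Finset.univ_inter]
  exact Finset.sum_congr rfl fun j _ => mul_comm _ _

/-- The quadrature error on polynomials of degree at most `2k` is a nonnegative multiple of the
coefficient of degree `2k`: dividing by the nodal polynomial `Ω` leaves the integral of `Ω q`,
which is zero for the Radau rule and reduces to the integral of `Ω²` for the Gauss rule. -/
theorem exists_quadrature_error (hy : IsSubdivision kind k y) : ∃ θ : ℝ, 0 ≤ θ ∧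
    ∀ f : ℝ[X], f.natDegree ≤ 2 * k →
      polyIntegral f - quadrature kind k y f = θ * f.coeff (2 * k) := by
  set Ω := nodal kind k y with hΩ
  have hmonic : Ω.Monic := Lagrange.nodal_monic
  have hΩdeg : Ω.natDegree = (quadNodes kind k).card := Lagrange.natDegree_nodal
  have herr : ∀ f : ℝ[X], polyIntegral f - quadrature kind k y f =
      polyIntegral (Ω * (f /ₘ Ω)) := by
    intro f
    have hmod : (f %ₘ Ω).degree < (quadNodes kind k).card := by
      rw [← hΩdeg, ← degree_eq_natDegree hmonic.ne_zero]
      exact degree_modByMonic_lt f hmonic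
    have h1 := quadrature_eq_of_degree_lt hy _ hmod
    have h2 : quadrature kind k y f = quadrature kind k y (f %ₘ Ω) := by
      refine Finset.sum_congr rfl fun j _ => ?_
      by_cases hj : j ∈ quadNodes kind k
      · conv_lhs => rw [← modByMonic_add_div f Ω]
        rw [eval_add, eval_mul, hΩ, nodal, Lagrange.eval_nodal_at_node hj, zero_mul, add_zero]
      · simp [quadWeight, hj]
    rw [h2, h1, sub_eq_iff_eq_add, ← map_add, add_comm, modByMonic_add_div]
  have hqdeg : ∀ f : ℝ[X], f.natDegree ≤ 2 * k →
      (f /ₘ Ω).natDegree ≤ 2 * k - (quadNodes kind k).card := by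
    intro f hf
    rw [natDegree_divByMonic _ hmonic, hΩdeg]
    omega
  cases kind with
  | RRSV =>
    refine ⟨0, le_rfl, fun f hf => ?_⟩
    rw [herr, zero_mul]
    by_cases hq : f /ₘ Ω = 0
    · simp [hq]
    refine polyIntegral_nodal_mul hy _ ((natDegree_lt_iff_degree_lt hq).1 ?_)
    have := hqdeg f hf
    have hlt : ¬ f.natDegree < Ω.natDegree := fun hlt =>
      hq ((divByMonic_eq_zero_iff hmonic).2 (degree_lt_degree hlt))
    rw [card_quadNodes] at this hΩdeg
    simp only at this hΩdeg
    omega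
  | LSV =>
    refine ⟨polyIntegral (Ω * Ω), polyIntegral_self_nonneg Ω, fun f hf => ?_⟩
    rw [card_quadNodes] at hΩdeg hqdeg
    simp only at hΩdeg hqdeg
    have hq : (f /ₘ Ω).natDegree ≤ k := (hqdeg f hf).trans (by omega)
    have hcoeff : f.coeff (2 * k) = (f /ₘ Ω).coeff k := by
      have hmod : (f %ₘ Ω).coeff (2 * k) = 0 := by
        refine coeff_eq_zero_of_degree_lt ((degree_modByMonic_lt f hmonic).trans_le ?_)
        rw [degree_eq_natDegree hmonic.ne_zero, hΩdeg]
        exact_mod_cast (by omega : k ≤ 2 * k)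
      conv_lhs => rw [← modByMonic_add_div f Ω]
      rw [coeff_add, hmod, zero_add, two_mul, coeff_mul_add_eq_of_natDegree_le hΩdeg.le hq]
      nth_rw 1 [← hΩdeg]
      rw [hmonic.coeff_natDegree, one_mul]
    have hlow : (f /ₘ Ω - C ((f /ₘ Ω).coeff k) * Ω).degree < k := by
      rw [degree_lt_iff_coeff_zero]
      intro m hm
      rw [coeff_sub, coeff_C_mul]
      rcases hm.eq_or_lt with rfl | hm
      · nth_rw 3 [← hΩdeg]
        rw [hmonic.coeff_natDegree]
        ring
      · rw [coeff_eq_zero_of_natDegree_lt (hq.trans_lt hm),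
          coeff_eq_zero_of_natDegree_lt (hΩdeg.le.trans_lt hm)]
        ring
    have h := polyIntegral_nodal_mul hy _ hlow
    rw [← hΩ, mul_sub, map_sub, mul_left_comm, ← smul_eq_C_mul, map_smul, smul_eq_mul] at h
    rw [herr, hcoeff]
    linarith

/-! ### The forms on the reference element -/

/-- The values on the control volumes of the test function associated with `w` on `[-1,1]`. -/
noncomputable def refTest (kind : SVKind) (k : ℕ) (y : Fin (k + 2) → ℝ) (w : ℝ[X])
    (j : Fin (k + 1)) : ℝ :=
  w.eval (-1) + ∑ r ∈ Finset.univ.filter (fun r : Fin (k + 2) => r ≤ j.castSucc),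
    quadWeight kind k y r * (derivative w).eval (y r)

theorem sum_ite_le_castSucc_sub (n : ℕ) (F : Fin (n + 1) → ℝ) (r : Fin (n + 1)) :
    ∑ j : Fin n, (if r ≤ j.castSucc then F j.succ - F j.castSucc else 0) =
      F (Fin.last n) - F r := by
  induction n with
  | zero =>
    have : Subsingleton (Fin (0 + 1)) := inferInstanceAs (Subsingleton (Fin 1))
    simp [Subsingleton.elim r (Fin.last 0)]
  | succ n ih =>
    rw [Fin.sum_univ_castSucc]
    refine Fin.lastCases ?_ (fun r => ?_) r
    · have : ∀ j : Fin (n + 1), ¬ Fin.last (n + 1) ≤ j.castSucc := fun j =>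
        not_le.2 (Fin.castSucc_lt_last j)
      simp [this]
    · have h := ih (F ∘ Fin.castSucc) r
      simp only [Function.comp_apply, ← Fin.succ_castSucc] at h
      simp only [Fin.castSucc_le_castSucc_iff, h, Fin.le_last, if_true, Fin.succ_last]
      ring

/-- Abel summation against a piecewise constant function with jumps `g`. -/
theorem sum_mul_sub_by_parts (n : ℕ) (c : ℝ) (g F : Fin (n + 1) → ℝ) :
    ∑ j : Fin n, (c + ∑ r ∈ Finset.univ.filter (fun r => r ≤ j.castSucc), g r) *
        (F j.succ - F j.castSucc) =
      (c + ∑ r, g r) * F (Fin.last n) - c * F 0 - ∑ r, g r * F r := by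
  have h0 := sum_ite_le_castSucc_sub n F 0
  simp only [Fin.zero_le, if_true] at h0
  have h1 : ∑ j : Fin n, (∑ r ∈ Finset.univ.filter (fun r => r ≤ j.castSucc), g r) *
      (F j.succ - F j.castSucc) = ∑ r, g r * (F (Fin.last n) - F r) := by
    simp only [← sum_ite_le_castSucc_sub, Finset.sum_filter, Finset.sum_mul, Finset.mul_sum]
    rw [Finset.sum_comm]
    refine Finset.sum_congr rfl fun r _ => Finset.sum_congr rfl fun j _ => ?_
    split_ifs <;> simp
  have h2 : ∀ j : Fin n, (c + ∑ r ∈ Finset.univ.filter (fun r => r ≤ j.castSucc), g r) *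
      (F j.succ - F j.castSucc) = c * (F j.succ - F j.castSucc) +
        (∑ r ∈ Finset.univ.filter (fun r => r ≤ j.castSucc), g r) *
          (F j.succ - F j.castSucc) := fun j => add_mul _ _ _
  simp only [h2]
  rw [Finset.sum_add_distrib, h1, ← Finset.mul_sum, h0]
  simp only [mul_sub, Finset.sum_sub_distrib, ← Finset.sum_mul]
  ring

theorem sum_refTest_mul_sub (hy : IsSubdivision kind k y) (hk : 1 ≤ k) (w F : ℝ[X])
    (hw : w.natDegree ≤ k) :
    ∑ j : Fin (k + 1), refTest kind k y w j * (F.eval (y j.succ) - F.eval (y j.castSucc)) =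
      w.eval 1 * F.eval 1 - w.eval (-1) * F.eval (-1) -
        quadrature kind k y (derivative w * F) := by
  have h := sum_mul_sub_by_parts (k + 1) (w.eval (-1))
    (fun r => quadWeight kind k y r * (derivative w).eval (y r)) (fun r => F.eval (y r))
  have hdeg : (derivative w).degree < (quadNodes kind k).card := by
    refine lt_of_lt_of_le ?_ (Nat.cast_le.2 (le_card_quadNodes kind k))
    refine degree_le_natDegree.trans_lt (Nat.cast_lt.2 ?_)
    have := natDegree_derivative_le w
    omega
  have hQ : ∑ r, quadWeight kind k y r * (derivative w).eval (y r) = w.eval 1 - w.eval (-1) := by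
    rw [← integral_eval_derivative]
    exact quadrature_eq_of_degree_lt hy _ hdeg
  simp only [refTest]
  rw [h, hQ, hy.first, hy.last, quadrature]
  simp only [eval_mul, mul_assoc]
  ring

/-- The antiderivative, with its top coefficient. -/
theorem exists_derivative_eq (p : ℝ[X]) (hp : p.natDegree ≤ k) :
    ∃ P : ℝ[X], derivative P = p ∧ P.natDegree ≤ k + 1 ∧ P.coeff (k + 1) = p.coeff k / (k + 1) := by
  refine ⟨∑ n ∈ Finset.range (k + 1), monomial (n + 1) (p.coeff n / (n + 1)), ?_, ?_, ?_⟩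
  · conv_rhs => rw [p.as_sum_range' (k + 1) (by omega)]
    rw [derivative_sum]
    refine Finset.sum_congr rfl fun n _ => ?_
    rw [derivative_monomial]
    congr 1
    push_cast
    field_simp
  · refine natDegree_sum_le_of_forall_le _ _ fun n hn => ?_
    refine (natDegree_monomial_le _).trans ?_
    have := Finset.mem_range.1 hn
    omega
  · simp [finsetSum_coeff, coeff_monomial]

/-- The inner product `∫ p q + θ p_k q_k` on the reference element. -/
noncomputable def refForm (k : ℕ) (θ : ℝ) : LinearMap.BilinForm ℝ ℝ[X] :=
  (LinearMap.mul ℝ ℝ[X]).compr₂ polyIntegral +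
    θ • (LinearMap.mul ℝ ℝ).compl₁₂ (lcoeff ℝ k) (lcoeff ℝ k)

theorem refForm_apply (θ : ℝ) (p q : ℝ[X]) :
    refForm k θ p q = polyIntegral (p * q) + θ * (p.coeff k * q.coeff k) := by
  simp [refForm]

theorem refForm_comm (θ : ℝ) (p q : ℝ[X]) : refForm k θ p q = refForm k θ q p := by
  rw [refForm_apply, refForm_apply, mul_comm p q, mul_comm (p.coeff k)]

theorem refForm_self_nonneg {θ : ℝ} (hθ : 0 ≤ θ) (p : ℝ[X]) : 0 ≤ refForm k θ p p := by
  rw [refForm_apply]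
  have := polyIntegral_self_nonneg p
  have := mul_self_nonneg (p.coeff k)
  positivity

theorem polyIntegral_le_refForm {θ : ℝ} (hθ : 0 ≤ θ) (p : ℝ[X]) :
    polyIntegral (p * p) ≤ refForm k θ p p := by
  rw [refForm_apply]
  have := mul_self_nonneg (p.coeff k)
  have : 0 ≤ θ * (p.coeff k * p.coeff k) := by positivity
  linarith

theorem eq_zero_of_refForm_self_eq_zero {θ : ℝ} (hθ : 0 ≤ θ) (p : ℝ[X])
    (h : refForm k θ p p = 0) : p = 0 :=
  eq_zero_of_polyIntegral_self_eq_zero p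
    (le_antisymm ((polyIntegral_le_refForm hθ p).trans h.le) (polyIntegral_self_nonneg p))

/-- Testing with `w*` is the inner product `refForm` for control volume averages, and the
integral against `w` for fluxes: both follow by Abel summation, since the jumps of `w*` are the
quadrature weights times `w'`. -/
theorem exists_refForm (hy : IsSubdivision kind k y) (hk : 1 ≤ k) : ∃ θ : ℝ, 0 ≤ θ ∧
    (∀ v w : ℝ[X], v.natDegree ≤ k → w.natDegree ≤ k →
      ∑ j : Fin (k + 1), refTest kind k y w j *
        (∫ t in (y j.castSucc)..(y j.succ), v.eval t) = refForm k θ v w) ∧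
    ∀ v w : ℝ[X], v.natDegree ≤ k → w.natDegree ≤ k →
      ∑ j : Fin (k + 1), refTest kind k y w j * (v.eval (y j.succ) - v.eval (y j.castSucc)) =
        polyIntegral (w * derivative v) := by
  obtain ⟨θ, hθ, herr⟩ := exists_quadrature_error hy
  have hder : ∀ w : ℝ[X], w.natDegree ≤ k → (derivative w).natDegree ≤ k - 1 := by
    intro w hw
    have := natDegree_derivative_le w
    omega
  refine ⟨θ * (k / (k + 1)), by positivity, fun v w hv hw => ?_, fun v w hv hw => ?_⟩
  · obtain ⟨P, rfl, hPdeg, hPcoeff⟩ := exists_derivative_eq v hv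
    simp only [integral_eval_derivative]
    rw [sum_refTest_mul_sub hy hk w P hw]
    have h := herr (derivative w * P) (natDegree_mul_le.trans (by have := hder w hw; omega))
    have hc : (derivative w * P).coeff (2 * k) =
        k / (k + 1) * ((derivative P).coeff k * w.coeff k) := by
      rw [show 2 * k = (k - 1) + (k + 1) by omega,
        coeff_mul_add_eq_of_natDegree_le (hder w hw) hPdeg, hPcoeff, coeff_derivative,
        Nat.sub_add_cancel hk]
      have : ((k - 1 : ℕ) : ℝ) + 1 = k := by
        rw [Nat.cast_sub hk]
        simp
      rw [this]
      ring
    rw [hc, polyIntegral_derivative_mul] at h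
    rw [refForm_apply, mul_comm (derivative P) w]
    linarith
  · rw [sum_refTest_mul_sub hy hk w v hw]
    have hd : (derivative w * v).natDegree < 2 * k :=
      natDegree_mul_le.trans_lt (by have := hder w hw; omega)
    have h := herr (derivative w * v) hd.le
    rw [coeff_eq_zero_of_natDegree_lt hd, polyIntegral_derivative_mul] at h
    linarith

end Quadrature

/-! ### Functionals on polynomials of bounded degree -/

/-- By the Riesz representation with respect to `refForm`, every functional is bounded on
polynomials of degree at most `k`. -/
theorem exists_functional_bound (k : ℕ) {θ : ℝ} (hθ : 0 ≤ θ) (ℓ : ℝ[X] →ₗ[ℝ] ℝ) :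
    ∃ c : ℝ, 0 ≤ c ∧ ∀ p : ℝ[X], p.natDegree ≤ k → ℓ p ^ 2 ≤ c * refForm k θ p p := by
  -- the Riesz representation is taken in the finite-dimensional subspace
  let ι := (degreeLT ℝ (k + 1)).subtype
  let B : LinearMap.BilinForm ℝ (degreeLT ℝ (k + 1)) := (refForm k θ).compl₁₂ ι ι
  have hdef : ∀ p, B p p = 0 → p = 0 := fun p hp =>
    Subtype.ext (eq_zero_of_refForm_self_eq_zero hθ _ hp)
  have hB : B.Nondegenerate := ⟨fun p hp => hdef p (hp p), fun p hp => hdef p (hp p)⟩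
  let g := (B.toDual hB).symm (ℓ ∘ₗ ι)
  refine ⟨refForm k θ g g, refForm_self_nonneg hθ _, fun p hp => ?_⟩
  have hmem : p ∈ degreeLT ℝ (k + 1) := by
    rw [mem_degreeLT]
    exact degree_le_natDegree.trans_lt (Nat.cast_lt.2 (Nat.lt_succ_of_le hp))
  have hg : ℓ p = refForm k θ g p :=
    (LinearMap.BilinForm.apply_toDual_symm_apply (hB := hB) (ℓ ∘ₗ ι) ⟨p, hmem⟩).symm
  rw [hg]
  exact LinearMap.BilinForm.apply_sq_le_of_symm _ (refForm_self_nonneg hθ)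
    ⟨fun p q => refForm_comm θ p q⟩ _ _

theorem exists_functional_bound_sum (k : ℕ) {θ : ℝ} (hθ : 0 ≤ θ) {ι : Type*} (t : Finset ι)
    (ℓ : ι → ℝ[X] →ₗ[ℝ] ℝ) :
    ∃ c : ℝ, 0 ≤ c ∧ ∀ p : ℝ[X], p.natDegree ≤ k → ∑ n ∈ t, ℓ n p ^ 2 ≤ c * refForm k θ p p := by
  choose c hc hbound using fun n => exists_functional_bound k hθ (ℓ n)
  refine ⟨∑ n ∈ t, c n, Finset.sum_nonneg fun n _ => hc n, fun p hp => ?_⟩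
  rw [Finset.sum_mul]
  exact Finset.sum_le_sum fun n _ => hbound n p hp

/-! ### Transformation to the reference element -/

section Space

variable {a b : ℝ} {N k : ℕ} (m : Mesh a b N)

theorem Mesh.len_pos (i : Fin N) : 0 < m.len i :=
  sub_pos.2 (m.strictMono i.castSucc_lt_succ)

/-- The restriction of a piecewise polynomial to an element, transformed to `[-1,1]`. -/
noncomputable def Mesh.refPoly (i : Fin N) : TrialSpace N k →ₗ[ℝ] ℝ[X] where
  toFun v := (v i : ℝ[X]).comp (C (m.len i / 2) * X + C ((m.left i + m.right i) / 2))
  map_add' v w := by simp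
  map_smul' c v := by simp [smul_comp]

theorem Mesh.refPoly_apply (i : Fin N) (v : TrialSpace N k) : m.refPoly i v =
    (v i : ℝ[X]).comp (C (m.len i / 2) * X + C ((m.left i + m.right i) / 2)) := rfl

theorem Mesh.eval_refPoly (i : Fin N) (v : TrialSpace N k) (t : ℝ) : (m.refPoly i v).eval t =
    (v i : ℝ[X]).eval (m.len i / 2 * t + (m.left i + m.right i) / 2) := by
  simp [Mesh.refPoly_apply, eval_comp]

theorem Mesh.eval_refPoly_one (i : Fin N) (v : TrialSpace N k) :
    (m.refPoly i v).eval 1 = (v i : ℝ[X]).eval (m.right i) := by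
  rw [m.eval_refPoly, Mesh.len]
  congr 1
  ring

theorem Mesh.eval_refPoly_neg_one (i : Fin N) (v : TrialSpace N k) :
    (m.refPoly i v).eval (-1) = (v i : ℝ[X]).eval (m.left i) := by
  rw [m.eval_refPoly, Mesh.len]
  congr 1
  ring

theorem natDegree_le_of_degreeLT (p : degreeLT ℝ (k + 1)) : (p : ℝ[X]).natDegree ≤ k := by
  have h := mem_degreeLT.1 p.2
  exact natDegree_le_iff_degree_le.2 (Order.le_of_lt_succ (by exact_mod_cast h))

theorem Mesh.natDegree_refPoly_le (i : Fin N) (v : TrialSpace N k) :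
    (m.refPoly i v).natDegree ≤ k := by
  rw [Mesh.refPoly_apply]
  refine natDegree_comp_le.trans ?_
  calc _ ≤ k * 1 := Nat.mul_le_mul (natDegree_le_of_degreeLT _) natDegree_linear_le
    _ = k := mul_one k

theorem Mesh.eq_zero_of_refPoly_eq_zero (v : TrialSpace N k) (h : ∀ i, m.refPoly i v = 0) :
    v = 0 := by
  funext i
  apply Subtype.ext
  refine Polynomial.funext fun x => ?_
  have hlen := m.len_pos i
  have hx := congrArg (eval ((x - (m.left i + m.right i) / 2) / (m.len i / 2))) (h i)
  rw [m.eval_refPoly, mul_div_cancel₀ _ (by positivity), sub_add_cancel] at hx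
  simpa using hx

theorem Mesh.testMap_eq (kind : SVKind) (y : Fin (k + 2) → ℝ) (w : TrialSpace N k) (i : Fin N)
    (j : Fin (k + 1)) : testMap kind m y w i j = refTest kind k y (m.refPoly i w) j := by
  rw [testMap, refTest, m.eval_refPoly_neg_one]
  congr 1
  refine Finset.sum_congr rfl fun r _ => ?_
  rw [Mesh.refPoly_apply, derivative_comp]
  simp [eval_comp, Mesh.point]
  ring

theorem Mesh.cvIntegral_eq (y : Fin (k + 2) → ℝ) (v : TrialSpace N k) (i : Fin N)
    (j : Fin (k + 1)) : cvIntegral m y v i j =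
      m.len i / 2 * ∫ t in (y j.castSucc)..(y j.succ), (m.refPoly i v).eval t := by
  simp only [m.eval_refPoly]
  rw [intervalIntegral.mul_integral_comp_mul_add (f := fun x => (v i : ℝ[X]).eval x)]
  rfl

theorem Mesh.integral_sq_eq (v : TrialSpace N k) (i : Fin N) :
    ∫ x in (m.left i)..(m.right i), (v i : ℝ[X]).eval x ^ 2 =
      m.len i / 2 * polyIntegral (m.refPoly i v * m.refPoly i v) := by
  simp only [polyIntegral_apply, ← pow_two, eval_pow, m.eval_refPoly]
  rw [intervalIntegral.mul_integral_comp_mul_add (f := fun x => (v i : ℝ[X]).eval x ^ 2)]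
  congr 1 <;> simp only [Mesh.len] <;> ring

/-! ### The energy form -/

/-- The scalar product `(v, w*)` as a bilinear form, in terms of the reference elements. -/
noncomputable def energyForm (θ : ℝ) : LinearMap.BilinForm ℝ (TrialSpace N k) :=
  ∑ i, (m.len i / 2) • (refForm k θ).compl₁₂ (m.refPoly i) (m.refPoly i)

theorem energyForm_apply (θ : ℝ) (v w : TrialSpace N k) : energyForm m θ v w =
    ∑ i, m.len i / 2 * refForm k θ (m.refPoly i v) (m.refPoly i w) := by
  simp [energyForm, LinearMap.sum_apply]

theorem energyForm_comm (θ : ℝ) (v w : TrialSpace N k) :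
    energyForm m θ v w = energyForm m θ w v := by
  simp only [energyForm_apply, refForm_comm θ (m.refPoly _ v)]

theorem energyForm_self_nonneg {θ : ℝ} (hθ : 0 ≤ θ) (v : TrialSpace N k) :
    0 ≤ energyForm m θ v v := by
  rw [energyForm_apply]
  refine Finset.sum_nonneg fun i _ => ?_
  have := m.len_pos i
  have := refForm_self_nonneg (k := k) hθ (m.refPoly i v)
  positivity

theorem eq_zero_of_energyForm_self_eq_zero {θ : ℝ} (hθ : 0 ≤ θ) (v : TrialSpace N k)
    (h : energyForm m θ v v = 0) : v = 0 := by
  refine m.eq_zero_of_refPoly_eq_zero v fun i => eq_zero_of_refForm_self_eq_zero (k := k) hθ _ ?_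
  rw [energyForm_apply, Finset.sum_eq_zero_iff_of_nonneg] at h
  · have := m.len_pos i
    exact (mul_eq_zero.1 (h i (Finset.mem_univ i))).resolve_left (by positivity)
  · intro i _
    have := m.len_pos i
    have := refForm_self_nonneg (k := k) hθ (m.refPoly i v)
    positivity

theorem energyForm_nondegenerate {θ : ℝ} (hθ : 0 ≤ θ) :
    (energyForm m θ : LinearMap.BilinForm ℝ (TrialSpace N k)).Nondegenerate :=
  ⟨fun v hv => eq_zero_of_energyForm_self_eq_zero m hθ v (hv v),
    fun v hv => eq_zero_of_energyForm_self_eq_zero m hθ v (hv v)⟩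

theorem l2Norm_sq (v : TrialSpace N k) : l2Norm m v ^ 2 =
    ∑ i, m.len i / 2 * polyIntegral (m.refPoly i v * m.refPoly i v) := by
  rw [l2Norm, Real.sq_sqrt]
  · simp only [m.integral_sq_eq]
  · simp only [m.integral_sq_eq]
    refine Finset.sum_nonneg fun i _ => ?_
    have := m.len_pos i
    have := polyIntegral_self_nonneg (m.refPoly i v)
    positivity

/-! ### The upwind flux form -/

/-- The left limit at the left end of an element, as a linear functional. -/
noncomputable def upwindMap (bc : BoundaryCondition) (i : Fin N) : TrialSpace N k →ₗ[ℝ] ℝ where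
  toFun v := upwindTrace bc m v i
  map_add' v w := by
    unfold upwindTrace
    split_ifs
    · cases bc <;> simp
    · simp
  map_smul' c v := by
    unfold upwindTrace
    split_ifs
    · cases bc <;> simp
    · simp

theorem upwindMap_apply (bc : BoundaryCondition) (i : Fin N) (v : TrialSpace N k) :
    upwindMap m bc i v = upwindTrace bc m v i := rfl

/-- The left limits at the left ends are left limits at the right ends of the elements, except for
the inflow value zero. -/
theorem sum_upwindTrace_sq_le (bc : BoundaryCondition) (v : TrialSpace N k) :
    ∑ i, upwindTrace bc m v i ^ 2 ≤ ∑ i, (m.refPoly i v).eval 1 ^ 2 := by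
  simp only [m.eval_refPoly_one]
  cases N with
  | zero => simp
  | succ n =>
    rw [Fin.sum_univ_succ, Fin.sum_univ_castSucc (f := fun i => eval (m.right i) (v i : ℝ[X]) ^ 2),
      add_comm]
    refine add_le_add (Finset.sum_le_sum fun j _ => le_of_eq ?_) ?_
    · unfold upwindTrace
      rw [if_neg (by simp)]
      rfl
    · unfold upwindTrace
      rw [if_pos (by simp)]
      cases bc with
      | periodic =>
        have : b = m.right (Fin.last n) := m.last.symm
        simp only
        exact le_of_eq (congrArg (fun x => eval x (v (Fin.last n) : ℝ[X]) ^ 2) this)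
      | inflow =>
        simp only
        rw [zero_pow two_ne_zero]
        exact sq_nonneg _

/-- The upwind discretization `∑ᵢ ∫ w v_x + w⁺ [v]` of the transport operator. -/
noncomputable def fluxForm (bc : BoundaryCondition) : LinearMap.BilinForm ℝ (TrialSpace N k) :=
  ∑ i, (((LinearMap.mul ℝ ℝ[X]).compr₂ polyIntegral).compl₁₂
      (derivative ∘ₗ m.refPoly i) (m.refPoly i) +
    (LinearMap.mul ℝ ℝ).compl₁₂ (leval (-1) ∘ₗ m.refPoly i - upwindMap m bc i)
      (leval (-1) ∘ₗ m.refPoly i))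

theorem fluxForm_apply (bc : BoundaryCondition) (v w : TrialSpace N k) : fluxForm m bc v w =
    ∑ i, (polyIntegral (m.refPoly i w * derivative (m.refPoly i v)) +
      (m.refPoly i w).eval (-1) * ((m.refPoly i v).eval (-1) - upwindTrace bc m v i)) := by
  simp only [fluxForm, LinearMap.sum_apply, LinearMap.add_apply, LinearMap.compl₁₂_apply,
    LinearMap.compr₂_apply, LinearMap.mul_apply', LinearMap.comp_apply, LinearMap.sub_apply,
    leval_apply, upwindMap_apply, mul_comm]

/-- The upwind fluxes are dissipative: the element terms leave half the squared jumps and the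
difference of the squared traces, which telescopes. -/
theorem fluxForm_self_nonneg (bc : BoundaryCondition) (v : TrialSpace N k) :
    0 ≤ fluxForm m bc v v := by
  have h := sum_upwindTrace_sq_le m bc v
  rw [← sub_nonneg, ← Finset.sum_sub_distrib] at h
  rw [fluxForm_apply]
  have hle : ∑ i, ((m.refPoly i v).eval 1 ^ 2 - upwindTrace bc m v i ^ 2) * (1 / 2) ≤
      ∑ i, (polyIntegral (m.refPoly i v * derivative (m.refPoly i v)) +
        (m.refPoly i v).eval (-1) * ((m.refPoly i v).eval (-1) - upwindTrace bc m v i)) := by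
    refine Finset.sum_le_sum fun i _ => ?_
    have h1 := polyIntegral_derivative_mul (m.refPoly i v) (m.refPoly i v)
    rw [mul_comm (derivative _)] at h1
    nlinarith [sq_nonneg ((m.refPoly i v).eval (-1) - upwindTrace bc m v i)]
  rw [← Finset.sum_mul] at hle
  linarith

end Space

/-- The Cauchy–Schwarz inequality with one more summand. -/
theorem add_mul_sq_le {A B x : ℝ} (hA : 0 ≤ A) (hB : 0 ≤ B) (hx : x ^ 2 ≤ A * B) (ω J : ℝ) :
    (x + ω * J) ^ 2 ≤ (A + ω ^ 2) * (B + J ^ 2) := by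
  have h : 2 * (x * (ω * J)) ≤ A * J ^ 2 + ω ^ 2 * B := by
    have h1 : x ^ 2 * (ω * J) ^ 2 ≤ (A * J ^ 2) * (ω ^ 2 * B) := by
      calc _ ≤ A * B * (ω * J) ^ 2 := by gcongr
        _ = _ := by ring
    refine (abs_le_of_sq_le_sq' ?_ (by positivity)).2
    have := sq_nonneg (A * J ^ 2 - ω ^ 2 * B)
    linarith
  linarith

/-- The contribution of one element to the flux form, with upwind value `z`. -/
theorem exists_refFlux_bound (k : ℕ) {θ : ℝ} (hθ : 0 ≤ θ) :
    ∃ c : ℝ, 0 ≤ c ∧ ∀ p w : ℝ[X], p.natDegree ≤ k → w.natDegree ≤ k → ∀ z : ℝ,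
      (polyIntegral (w * derivative p) + w.eval (-1) * (p.eval (-1) - z)) ^ 2 ≤
        (c * refForm k θ w w) * (c * refForm k θ p p + 2 * z ^ 2) := by
  obtain ⟨c₁, hc₁, h₁⟩ := exists_functional_bound_sum k hθ (Finset.range (k + 1)) (lcoeff ℝ)
  obtain ⟨c₂, hc₂, h₂⟩ := exists_functional_bound_sum k hθ (Finset.range (k + 1))
    fun n => polyIntegral ∘ₗ LinearMap.mulLeft ℝ (X ^ n) ∘ₗ derivative
  obtain ⟨c₃, hc₃, h₃⟩ := exists_functional_bound k hθ (leval (-1))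
  refine ⟨c₁ + c₂ + 2 * c₃, by positivity, fun p w hp hw z => ?_⟩
  have hexp : polyIntegral (w * derivative p) =
      ∑ n ∈ Finset.range (k + 1), w.coeff n * polyIntegral (X ^ n * derivative p) := by
    conv_lhs => rw [w.as_sum_range_C_mul_X_pow' (by omega : w.natDegree < k + 1)]
    simp only [Finset.sum_mul, map_sum, ← smul_eq_C_mul, map_smul, smul_eq_mul, smul_mul_assoc]
  have b1 := h₁ w hw
  have b2 := h₂ p hp
  have b3 := h₃ w hw
  have b4 := h₃ p hp
  simp only [lcoeff_apply, leval_apply, LinearMap.comp_apply, LinearMap.mulLeft_apply]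
    at b1 b2 b3 b4
  have hcs := Finset.sum_mul_sq_le_sq_mul_sq (Finset.range (k + 1)) (fun n => w.coeff n)
    (fun n => polyIntegral (X ^ n * derivative p))
  rw [← hexp] at hcs
  have hqw := refForm_self_nonneg (k := k) hθ w
  have hqp := refForm_self_nonneg (k := k) hθ p
  have hA : 0 ≤ ∑ n ∈ Finset.range (k + 1), w.coeff n ^ 2 :=
    Finset.sum_nonneg fun n _ => sq_nonneg _
  have hB : 0 ≤ ∑ n ∈ Finset.range (k + 1), polyIntegral (X ^ n * derivative p) ^ 2 :=
    Finset.sum_nonneg fun n _ => sq_nonneg _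
  have hJ : (p.eval (-1) - z) ^ 2 ≤ 2 * p.eval (-1) ^ 2 + 2 * z ^ 2 := by
    linarith [sq_nonneg (p.eval (-1) + z)]
  have e1 := mul_nonneg hc₁ hqp
  have e2 := mul_nonneg hc₂ hqw
  have e3 := mul_nonneg hc₃ hqw
  refine (add_mul_sq_le hA hB hcs (w.eval (-1)) (p.eval (-1) - z)).trans
    (mul_le_mul ?_ ?_ (add_nonneg hB (sq_nonneg _)) ?_)
  · linarith
  · linarith
  · positivity

/-- The inverse inequality for the flux form. -/
theorem exists_fluxForm_bound (k : ℕ) {θ : ℝ} (hθ : 0 ≤ θ) :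
    ∃ c : ℝ, 0 ≤ c ∧ ∀ (a b : ℝ) (N : ℕ) (m : Mesh a b N) (bc : BoundaryCondition)
      (v w : TrialSpace N k), fluxForm m bc v w ^ 2 ≤
        c * (∑ i, refForm k θ (m.refPoly i v) (m.refPoly i v)) *
          ∑ i, refForm k θ (m.refPoly i w) (m.refPoly i w) := by
  obtain ⟨c, hc, hterm⟩ := exists_refFlux_bound k hθ
  obtain ⟨c', hc', hone⟩ := exists_functional_bound k hθ (leval 1)
  refine ⟨c * (c + 2 * c'), by positivity, fun a b N m bc v w => ?_⟩
  have hq : ∀ (v : TrialSpace N k) i, 0 ≤ refForm k θ (m.refPoly i v) (m.refPoly i v) :=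
    fun v i => refForm_self_nonneg hθ _
  have hsum : fluxForm m bc v w ^ 2 ≤ (∑ i, c * refForm k θ (m.refPoly i w) (m.refPoly i w)) *
      ∑ i, (c * refForm k θ (m.refPoly i v) (m.refPoly i v) + 2 * upwindTrace bc m v i ^ 2) := by
    rw [fluxForm_apply]
    refine Finset.sum_sq_le_sum_mul_sum_of_sq_le_mul _ (fun i _ => mul_nonneg hc (hq w i))
      (fun i _ => add_nonneg (mul_nonneg hc (hq v i)) (by positivity)) fun i _ =>
      hterm _ _ (m.natDegree_refPoly_le i v) (m.natDegree_refPoly_le i w) _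
  have hup : ∑ i, upwindTrace bc m v i ^ 2 ≤
      c' * ∑ i, refForm k θ (m.refPoly i v) (m.refPoly i v) := by
    rw [Finset.mul_sum]
    exact (sum_upwindTrace_sq_le m bc v).trans
      (Finset.sum_le_sum fun i _ => hone _ (m.natDegree_refPoly_le i v))
  refine hsum.trans ?_
  rw [Finset.sum_add_distrib, ← Finset.mul_sum, ← Finset.mul_sum, ← Finset.mul_sum]
  have hQw : 0 ≤ ∑ i, refForm k θ (m.refPoly i w) (m.refPoly i w) :=
    Finset.sum_nonneg fun i _ => hq w i
  have hmul := mul_le_mul_of_nonneg_left hup (mul_nonneg (mul_nonneg hc hQw) zero_le_two)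
  linarith

/-! ### The scheme as powers of a dissipative operator -/

section Scheme

variable {a b : ℝ} {N k : ℕ} (m : Mesh a b N) {kind : SVKind} {y : Fin (k + 2) → ℝ} {θ : ℝ}

theorem energyInner_eq_energyForm
    (hθ : ∀ v w : ℝ[X], v.natDegree ≤ k → w.natDegree ≤ k →
      ∑ j : Fin (k + 1), refTest kind k y w j *
        (∫ t in (y j.castSucc)..(y j.succ), v.eval t) = refForm k θ v w)
    (v w : TrialSpace N k) : energyInner kind m y v w = energyForm m θ v w := by
  rw [energyInner, energyForm_apply]
  refine Finset.sum_congr rfl fun i _ => ?_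
  rw [← hθ _ _ (m.natDegree_refPoly_le i v) (m.natDegree_refPoly_le i w), Finset.mul_sum]
  refine Finset.sum_congr rfl fun j _ => ?_
  rw [m.testMap_eq, m.cvIntegral_eq]
  ring

theorem energyNorm_sq (hθ0 : 0 ≤ θ)
    (hθ : ∀ v w : ℝ[X], v.natDegree ≤ k → w.natDegree ≤ k →
      ∑ j : Fin (k + 1), refTest kind k y w j *
        (∫ t in (y j.castSucc)..(y j.succ), v.eval t) = refForm k θ v w)
    (v : TrialSpace N k) : energyNorm kind m y v ^ 2 = energyForm m θ v v := by
  rw [energyNorm, energyInner_eq_energyForm m hθ, Real.sq_sqrt (energyForm_self_nonneg m hθ0 v)]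

theorem refTest_zero (w : ℝ[X]) : refTest kind k y w 0 = w.eval (-1) := by
  have h : quadWeight kind k y 0 = 0 := by
    rw [quadWeight, if_neg]
    cases kind <;> simp [quadNodes]
  rw [refTest, Finset.sum_eq_zero, add_zero]
  intro r hr
  have hr0 : r = 0 := by simpa using hr
  rw [hr0, h, zero_mul]

theorem sum_testMap_mul_flux (hy : IsSubdivision kind k y)
    (hflux : ∀ v w : ℝ[X], v.natDegree ≤ k → w.natDegree ≤ k →
      ∑ j : Fin (k + 1), refTest kind k y w j * (v.eval (y j.succ) - v.eval (y j.castSucc)) =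
        polyIntegral (w * derivative v))
    (bc : BoundaryCondition) (v w : TrialSpace N k) :
    ∑ i, ∑ j : Fin (k + 1), testMap kind m y w i j *
      (leftTrace bc m y v i j.succ - leftTrace bc m y v i j.castSucc) = fluxForm m bc v w := by
  rw [fluxForm_apply]
  refine Finset.sum_congr rfl fun i _ => ?_
  rw [← hflux _ _ (m.natDegree_refPoly_le i v) (m.natDegree_refPoly_le i w)]
  have hterm : ∀ j : Fin (k + 1), testMap kind m y w i j *
      (leftTrace bc m y v i j.succ - leftTrace bc m y v i j.castSucc) =
      refTest kind k y (m.refPoly i w) j *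
        ((m.refPoly i v).eval (y j.succ) - (m.refPoly i v).eval (y j.castSucc)) +
      if j = 0 then (m.refPoly i w).eval (-1) *
        ((m.refPoly i v).eval (-1) - upwindTrace bc m v i) else 0 := by
    intro j
    have hint : ∀ l : Fin (k + 2), l ≠ 0 →
        leftTrace bc m y v i l = (m.refPoly i v).eval (y l) := by
      intro l hl
      rw [leftTrace, if_neg hl, m.eval_refPoly]
      rfl
    rw [m.testMap_eq, hint _ (Fin.succ_ne_zero j)]
    by_cases hj : j = 0
    · subst hj
      rw [if_pos rfl, refTest_zero, Fin.castSucc_zero, hy.first, leftTrace, if_pos rfl]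
      ring
    · rw [if_neg hj, hint _ (by simpa using hj), add_zero]
  simp only [hterm]
  rw [Finset.sum_add_distrib, Finset.sum_ite_eq' Finset.univ 0]
  simp

theorem Mesh.len_le_hmax (i : Fin N) : m.len i ≤ m.hmax :=
  le_ciSup (Set.finite_range m.len).bddAbove i

theorem Mesh.hmin_le_len (i : Fin N) : m.hmin ≤ m.len i :=
  ciInf_le (Set.finite_range m.len).bddBelow i

theorem Mesh.hmax_pos (hab : a < b) : 0 < m.hmax := by
  cases N with
  | zero => exact absurd (m.first.symm.trans m.last) hab.ne
  | succ n => exact (m.len_pos 0).trans_le (m.len_le_hmax 0)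

theorem Mesh.sum_refForm_le_energyForm {r : ℝ} (hm : m.IsRegular r) (hθ : 0 ≤ θ)
    (v : TrialSpace N k) : r * m.hmax / 2 * ∑ i, refForm k θ (m.refPoly i v) (m.refPoly i v) ≤
      energyForm m θ v v := by
  rw [energyForm_apply, Finset.mul_sum]
  refine Finset.sum_le_sum fun i _ => mul_le_mul_of_nonneg_right ?_ (refForm_self_nonneg hθ _)
  have := hm.trans (m.hmin_le_len i)
  linarith

theorem exists_flux_operator (hθ : 0 ≤ θ) (bc : BoundaryCondition) (τ : ℝ) :
    ∃ K : TrialSpace N k →ₗ[ℝ] TrialSpace N k,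
      ∀ v w, energyForm m θ (K v) w = -τ * fluxForm m bc v w := by
  have hnd := energyForm_nondegenerate (k := k) m hθ
  refine ⟨(((energyForm m θ).toDual hnd).symm : _ →ₗ[ℝ] _) ∘ₗ (-τ • fluxForm m bc),
    fun v w => ?_⟩
  exact LinearMap.BilinForm.apply_toDual_symm_apply (hB := hnd) ((-τ • fluxForm m bc) v) w

/-- Testing the scheme with `w*` shows that the stages satisfy the Runge–Kutta recursion for the
operator representing the flux form. -/
theorem IsStep.eq_aeval_stagePoly {s : ℕ} {bc : BoundaryCondition} {τ : ℝ}
    {u u' : TrialSpace N k} (hstep : IsStep s bc m y τ u u') (hy : IsSubdivision kind k y)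
    (hθ0 : 0 ≤ θ)
    (hθ : ∀ v w : ℝ[X], v.natDegree ≤ k → w.natDegree ≤ k →
      ∑ j : Fin (k + 1), refTest kind k y w j *
        (∫ t in (y j.castSucc)..(y j.succ), v.eval t) = refForm k θ v w)
    (hflux : ∀ v w : ℝ[X], v.natDegree ≤ k → w.natDegree ≤ k →
      ∑ j : Fin (k + 1), refTest kind k y w j * (v.eval (y j.succ) - v.eval (y j.castSucc)) =
        polyIntegral (w * derivative v))
    (K : TrialSpace N k →ₗ[ℝ] TrialSpace N k)
    (hK : ∀ v w, energyForm m θ (K v) w = -τ * fluxForm m bc v w) :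
    u' = aeval K (stagePoly s s) u := by
  obtain ⟨U, rfl, rfl, hU⟩ := hstep
  refine RKSV.eq_aeval_stagePoly s K U (fun l hl => ?_) s le_rfl
  rw [← sub_eq_zero]
  refine (energyForm_nondegenerate m hθ0).1 _ fun w => ?_
  rw [map_sub, LinearMap.sub_apply, sub_eq_zero, ← energyInner_eq_energyForm m hθ, energyInner]
  simp only [hU l hl, map_sum, LinearMap.sum_apply, map_add, LinearMap.add_apply, map_smul,
    LinearMap.smul_apply, smul_eq_mul, hK, ← energyInner_eq_energyForm m hθ,
    ← sum_testMap_mul_flux m hy hflux, energyInner]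
  simp only [Finset.mul_sum, ← Finset.sum_add_distrib]
  conv_rhs => rw [Finset.sum_comm]
  refine Finset.sum_congr rfl fun i _ => ?_
  conv_rhs => rw [Finset.sum_comm]
  refine Finset.sum_congr rfl fun j _ => Finset.sum_congr rfl fun κ _ => ?_
  ring

end Scheme

theorem normEquivalence {k : ℕ} (hk : 1 ≤ k) {kind : SVKind} {y : Fin (k + 2) → ℝ}
    (hy : IsSubdivision kind k y) : NormEquivalence k kind y := by
  obtain ⟨θ, hθ0, hθ, -⟩ := exists_refForm hy hk
  obtain ⟨c, hc, hbound⟩ := exists_functional_bound k le_rfl (lcoeff ℝ k)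
  refine ⟨1, √(1 + θ * c), one_pos, by positivity, fun a b _ N m w => ?_⟩
  have hE := energyNorm_sq m hθ0 hθ w
  have hL := l2Norm_sq m w
  have hE0 : 0 ≤ energyNorm kind m y w := Real.sqrt_nonneg _
  have hL0 : 0 ≤ l2Norm m w := Real.sqrt_nonneg _
  rw [energyForm_apply] at hE
  constructor
  · rw [one_mul]
    refine (sq_le_sq₀ hL0 hE0).1 ?_
    rw [hE, hL]
    refine Finset.sum_le_sum fun i _ => ?_
    have := m.len_pos i
    have := polyIntegral_le_refForm (k := k) hθ0 (m.refPoly i w)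
    gcongr
  · refine (sq_le_sq₀ hE0 (by positivity)).1 ?_
    rw [mul_pow, Real.sq_sqrt (by positivity), hE, hL, Finset.mul_sum]
    refine Finset.sum_le_sum fun i _ => ?_
    have hlen := m.len_pos i
    have hb := hbound _ (m.natDegree_refPoly_le i w)
    rw [refForm_apply, zero_mul, add_zero, lcoeff_apply] at hb
    rw [refForm_apply]
    have hb' := mul_le_mul_of_nonneg_left (mul_le_mul_of_nonneg_left hb hθ0)
      (half_pos hlen).le
    linarith

/-- On regular meshes, a step of the scheme with CFL number `λ` is the Runge–Kutta method for a
dissipative operator of norm at most a multiple of `λ`. -/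
theorem exists_dissipative_operator (s : ℕ) {k : ℕ} (hk : 1 ≤ k) {kind : SVKind}
    (bc : BoundaryCondition) {y : Fin (k + 2) → ℝ} (hy : IsSubdivision kind k y) {r : ℝ}
    (hr : 0 < r) : ∃ κ : ℝ, 0 < κ ∧ ∀ (a b : ℝ), a < b → ∀ (N : ℕ) (m : Mesh a b N),
      m.IsRegular r → ∀ τ : ℝ, 0 < τ →
        ∃ (E : LinearMap.BilinForm ℝ (TrialSpace N k)) (K : TrialSpace N k →ₗ[ℝ] TrialSpace N k),
          (∀ v w, E v w = E w v) ∧ (∀ v, 0 ≤ E v v) ∧ (∀ v, E (K v) v ≤ 0) ∧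
          (∀ v, E (K v) (K v) ≤ (κ * (τ / m.hmax)) ^ 2 * E v v) ∧
          (∀ v, energyNorm kind m y v ^ 2 = E v v) ∧
          ∀ u u', IsStep s bc m y τ u u' → u' = aeval K (stagePoly s s) u := by
  obtain ⟨θ, hθ0, hθ, hflux⟩ := exists_refForm hy hk
  obtain ⟨c, hc, hbound⟩ := exists_fluxForm_bound k hθ0
  refine ⟨2 * (c + 1) / r, by positivity, fun a b hab N m hm τ hτ => ?_⟩
  obtain ⟨K, hK⟩ := exists_flux_operator (k := k) m hθ0 bc τ
  refine ⟨energyForm m θ, K, energyForm_comm m θ, energyForm_self_nonneg m hθ0, fun v => ?_,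
    fun v => ?_, energyNorm_sq m hθ0 hθ,
    fun u u' hstep => hstep.eq_aeval_stagePoly m hy hθ0 hθ hflux K hK⟩
  · rw [hK]
    have := mul_nonneg hτ.le (fluxForm_self_nonneg m bc v)
    linarith
  · have hh := m.hmax_pos hab
    have h1 := hbound a b N m bc v (K v)
    have hv := m.sum_refForm_le_energyForm hm hθ0 v
    have hKv := m.sum_refForm_le_energyForm hm hθ0 (K v)
    have hEv := energyForm_self_nonneg m hθ0 v
    have hEKv := energyForm_self_nonneg m hθ0 (K v)
    have hsq : energyForm m θ (K v) (K v) ^ 2 = τ ^ 2 * fluxForm m bc v (K v) ^ 2 := by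
      rw [hK]
      ring
    set x := energyForm m θ (K v) (K v)
    set e := energyForm m θ v v
    set A := ∑ i, refForm k θ (m.refPoly i v) (m.refPoly i v)
    set B := ∑ i, refForm k θ (m.refPoly i (K v)) (m.refPoly i (K v))
    have hB0 : 0 ≤ B := Finset.sum_nonneg fun i _ => refForm_self_nonneg hθ0 _
    have hA0 : 0 ≤ A := Finset.sum_nonneg fun i _ => refForm_self_nonneg hθ0 _
    have hrh : 0 < r * m.hmax / 2 := by positivity
    have hA : A ≤ e / (r * m.hmax / 2) := by
      rw [le_div_iff₀ hrh]
      linarith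
    have hB : B ≤ x / (r * m.hmax / 2) := by
      rw [le_div_iff₀ hrh]
      linarith
    have hx : x ^ 2 ≤ (2 * (c + 1) / r * (τ / m.hmax)) ^ 2 * e * x := by
      calc x ^ 2 = τ ^ 2 * fluxForm m bc v (K v) ^ 2 := hsq
        _ ≤ τ ^ 2 * (c * A * B) := by gcongr
        _ ≤ τ ^ 2 * ((c + 1) ^ 2 * (e / (r * m.hmax / 2)) * (x / (r * m.hmax / 2))) := by
          have hc2 : c ≤ (c + 1) ^ 2 := by nlinarith
          gcongr
        _ = _ := by
          field_simp
    rcases hEKv.eq_or_lt with h0 | h0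
    · rw [← h0]
      positivity
    · rw [pow_two x] at hx
      exact le_of_mul_le_mul_right hx h0

end RKSV

theorem mainTheorem1 (s k : ℕ) (hs : 1 ≤ s) (hk : 1 ≤ k) (kind : RKSV.SVKind)
    (bc : RKSV.BoundaryCondition) (y : Fin (k + 2) → ℝ) (hy : RKSV.IsSubdivision kind k y)
    (α₀ : ℝ) (hα₀ : 0 < α₀) (r : ℝ) (hr : 0 < r) (ζ ρ : ℕ)
    (hζ : ζ = RKSV.terminationIndex s α₀) (hρ : ρ = RKSV.contributionIndex s α₀) :
    (1 ≤ ζ ∧ ζ ≤ s ∧ RKSV.transferA s α₀ ζ ζ ζ ≠ 0) ∧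
    RKSV.NormEquivalence k kind y ∧
    (RKSV.transferA s α₀ ζ ζ ζ < 0 → ρ = ζ → RKSV.MonotonicityStable s k kind bc y r) ∧
    (RKSV.transferA s α₀ ζ ζ ζ < 0 → ρ < ζ → RKSV.WeakStable (2 * ρ + 1) s k kind bc y r) ∧
    (0 < RKSV.transferA s α₀ ζ ζ ζ →
      RKSV.WeakStable (min (2 * ζ) (2 * ρ + 1)) s k kind bc y r) := by
  obtain ⟨c, μ₀, hc, hμ₀, hstab⟩ := RKSV.exists_stability_constant s hs α₀ hα₀ ζ ρ hζ hρ
  obtain ⟨κ, hκ, hop⟩ := RKSV.exists_dissipative_operator s hk bc hy hr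
  have main : ∀ φ : ℝ → ℝ,
      (∀ (V : Type) [AddCommGroup V] [Module ℝ V] (E : LinearMap.BilinForm ℝ V)
        (K : V →ₗ[ℝ] V) (lam : ℝ), (∀ v w, E v w = E w v) → (∀ v, 0 ≤ E v v) →
        (∀ v, E (K v) v ≤ 0) → 0 < lam → κ * lam ≤ μ₀ →
        (∀ v, E (K v) (K v) ≤ (κ * lam) ^ 2 * E v v) →
        ∀ u u' : V, u' = Polynomial.aeval K (RKSV.stagePoly s s) u → E u' u' ≤ φ lam * E u u) →
      RKSV.GrowthBound s k kind bc y r (μ₀ / κ) φ := by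
    intro φ hφ a b hab N m hm T M hT hM hlam u hu n hn
    have hτ : 0 < T / M := div_pos hT (by exact_mod_cast hM)
    obtain ⟨E, K, hE, hpos, hdiss, hK, hnorm, hstep⟩ := hop a b hab N m hm (T / M) hτ
    rw [hnorm, hnorm]
    refine hφ _ E K (T / M / m.hmax) hE hpos hdiss (div_pos hτ (m.hmax_pos hab)) ?_ hK _ _
      (hstep _ _ (hu n hn))
    rw [le_div_iff₀ hκ] at hlam
    linarith
  refine ⟨?_, RKSV.normEquivalence hk hy, fun hneg hρζ => ?_, fun hneg _ => ?_, fun _ => ?_⟩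
  · rw [hζ]
    exact RKSV.terminationIndex_spec s hs α₀ hα₀
  · refine ⟨μ₀ / κ, by positivity, main _ ?_⟩
    intro V _ _ E K lam hE hpos hdiss hlam hle hK u u' hu
    rw [one_mul]
    exact (hstab V E K _ hE hpos hdiss (by positivity) hle hK u u' hu).1 hneg hρζ
  · refine ⟨c * κ ^ (2 * ρ + 1), by positivity, μ₀ / κ, by positivity, main _ ?_⟩
    intro V _ _ E K lam hE hpos hdiss hlam hle hK u u' hu
    rw [mul_assoc c, ← mul_pow]
    exact (hstab V E K _ hE hpos hdiss (by positivity) hle hK u u' hu).2.1 hneg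
  · refine ⟨c * κ ^ min (2 * ζ) (2 * ρ + 1), by positivity, μ₀ / κ, by positivity, main _ ?_⟩
    intro V _ _ E K lam hE hpos hdiss hlam hle hK u u' hu
    rw [mul_assoc c, ← mul_pow]
    exact (hstab V E K _ hE hpos hdiss (by positivity) hle hK u u' hu).2.2
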